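/- Let $n_1,n_2\ge 1$ be integers and $q_1,q_2>0$ real numbers. For $Y=(Y_1,Y_2)\in\mathbb R^2$ put $$E(Y)=\tfrac12+4n_1q_1^2Y_1^2+4n_2q_2^2Y_2^2,\qquad F_i(Y)=2(n_i+2)q_iY_i-6q_i^2Y_i^2-E(Y)\quad(i=1,2),$$ and consider the system $$\frac{dY_i}{du}=-Y_iF_i(Y),\qquad i=1,2. \tag{$*$}$$ Let $v_1=\bigl(\tfrac1{(4n_1+6)q_1},0\bigr)$ and $v_2=\bigl(0,\tfrac1{(4n_2+6)q_2}\bigr)$, and let $\overline{0v_i}$ be the line segment joining $0$ and $v_i$. Let $\Omega_2$ be the bounded connected component of $\{Y: Y_1\ge0,\ Y_2\ge0,\ F_1(Y)\le0,\ F_2(Y)\le0\}$. Theorem. The system $(*)$ has exactly two stationary points $\eta,\xi$ with both coordinates positive, and they can be labelled so that $\eta_1<\xi_1$ and $\eta_2<\xi_2$. Put $D=\Omega_2\setminus(\overline{0v_1}\cup\overline{0v_2}\cup\{\eta\})$. Then: (i) For each $p\in D$ there is a solution $Y$ of $(*)$ on $[0,\infty)$ with $Y(0)=p$, and every such solution satisfies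 $\lim_{u\to\infty}Y(u)=\eta$. (ii) There is exactly one flow line in $D$ with backward limit $v_1$: there is a solution $\gamma_1:\mathbb R\to D$ of $(*)$ with $\lim_{u\to-\infty}\gamma_1(u)=v_1$, and every solution $Z$ of $(*)$ on $(-\infty,0]$ with $Z(0)\in D$ and $\lim_{u\to-\infty}Z(u)=v_1$ is of the form $Z(u)=\gamma_1(u+s)$ for some $s\in\mathbb R$. (iii) In the same sense there is exactly one flow line $\gamma_2$ in $D$ with backward limit $v_2$. (iv) Let $\Omega_2^*$ be the closed region bounded by $\overline{0v_1}$, $\overline{0v_2}$, $\gamma_1$ and $\gamma_2\cup\{\eta\}$, that is, the union $C$ of these sets together with the bounded components of $\mathbb R^2\setminus C$. Then $\Omega_2^*\subset\Omega_2$, and for each $p$ in the interior of $\Omega_2^*$ there is a solution $Y$ of $(*)$ on $(-\infty,0]$ with $Y(0)=p$, and every such solution satisfies $\lim_{u\to-\infty}Y(u)=0$. -/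

import Mathlib

open Set Filter Topology

noncomputable section

/-- `E(Y) = 1/2 + 4 n₁ q₁² Y₁² + 4 n₂ q₂² Y₂²` (indices `0, 1` stand for `1, 2`). -/
def energyE (n : Fin 2 → ℕ) (q : Fin 2 → ℝ) (Y : Fin 2 → ℝ) : ℝ :=
  1 / 2 + ∑ i, 4 * (n i : ℝ) * q i ^ 2 * Y i ^ 2

/-- `F_i(Y) = 2 (n_i + 2) q_i Y_i - 6 q_i² Y_i² - E(Y)`. -/
def fieldF (n : Fin 2 → ℕ) (q : Fin 2 → ℝ) (i : Fin 2) (Y : Fin 2 → ℝ) : ℝ :=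
  2 * ((n i : ℝ) + 2) * q i * Y i - 6 * q i ^ 2 * Y i ^ 2 - energyE n q Y

/-- The vector field `(-Y₁ F₁(Y), -Y₂ F₂(Y))`. -/
def flowField (n : Fin 2 → ℕ) (q : Fin 2 → ℝ) (Y : Fin 2 → ℝ) : Fin 2 → ℝ :=
  fun i => -(Y i * fieldF n q i Y)

/-- `Y` solves `dY_i/du = -Y_i F_i(Y)` on the time interval `I`
(with one-sided derivatives at the end points of `I`). -/
def IsSolutionOn (n : Fin 2 → ℕ) (q : Fin 2 → ℝ) (Y : ℝ → Fin 2 → ℝ) (I : Set ℝ) : Prop :=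
  ∀ u ∈ I, HasDerivWithinAt Y (flowField n q (Y u)) I u

/-- The zeros of the vector field with both coordinates positive. -/
def einsteinPoints (n : Fin 2 → ℕ) (q : Fin 2 → ℝ) : Set (Fin 2 → ℝ) :=
  {Y | (∀ i, 0 < Y i) ∧ flowField n q Y = 0}

/-- The zero `v_i` of the vector field on the `i`-th axis, with `i`-th coordinate
`1 / ((4 n_i + 6) q_i)`. -/
def saddlePoint (n : Fin 2 → ℕ) (q : Fin 2 → ℝ) (i : Fin 2) : Fin 2 → ℝ :=
  Pi.single i (1 / ((4 * (n i : ℝ) + 6) * q i))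

/-- The union of the bounded connected components of a subset of the plane. -/
def boundedComponents (S : Set (Fin 2 → ℝ)) : Set (Fin 2 → ℝ) :=
  {p | p ∈ S ∧ Bornology.IsBounded (connectedComponentIn S p)}

/-- `Ω₂`: the bounded component of `{Y : Y₁, Y₂ ≥ 0, F₁(Y) ≤ 0, F₂(Y) ≤ 0}`. -/
def omegaTwo (n : Fin 2 → ℕ) (q : Fin 2 → ℝ) : Set (Fin 2 → ℝ) :=
  boundedComponents {Y | ∀ i, 0 ≤ Y i ∧ fieldF n q i Y ≤ 0}

/-- The segment joining `0` and `v_i`. -/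
def axisSegment (n : Fin 2 → ℕ) (q : Fin 2 → ℝ) (i : Fin 2) : Set (Fin 2 → ℝ) :=
  segment ℝ 0 (saddlePoint n q i)

/-- The set of initial values: `Ω₂` without the two segments and without `η`. -/
def initialSet (n : Fin 2 → ℕ) (q : Fin 2 → ℝ) (η : Fin 2 → ℝ) : Set (Fin 2 → ℝ) :=
  omegaTwo n q \ (axisSegment n q 0 ∪ axisSegment n q 1 ∪ {η})

/-- The closed region bounded by a closed curve `C` in the plane: the curve together with the
bounded components of its complement. -/
def regionBoundedBy (C : Set (Fin 2 → ℝ)) : Set (Fin 2 → ℝ) :=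
  C ∪ boundedComponents Cᶜ

/-- `Ω₂*`: the closed region bounded by the two segments, the flow lines of `γ₁` and `γ₂`,
and the point `η`. -/
def omegaTwoStar (n : Fin 2 → ℕ) (q : Fin 2 → ℝ) (η : Fin 2 → ℝ)
    (γ : Fin 2 → ℝ → Fin 2 → ℝ) : Set (Fin 2 → ℝ) :=
  regionBoundedBy
    (axisSegment n q 0 ∪ axisSegment n q 1 ∪ range (γ 0) ∪ (range (γ 1) ∪ {η}))

end

/-!
The substitution `x = q₁ Y₁`, `y = q₂ Y₂` turns `F₁` and `F₂` into the two versions of `scaledF`.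

*Stationary points.* The positive zeros lie on a branch of the hyperbola `F₁ = F₂`, which is an
increasing curve through the origin. It is a convex graph over one of the axes, and the zeros also
lie on a strictly concave parabola over the same axis, so that there are at most two of them
(`not_three_zeros`); the intermediate value theorem along the branch gives two
(`exists_two_zeros_of_le`). They are separated by the box below `boxCorner`, on whose outer faces
`F₁` or `F₂` is positive. Hence `Ω₂` is the part `trappingRegion` of the sublevel region inside the
box (`omegaTwo_eq_trappingRegion`): at every other point of the sublevel region there starts a ray
contained in it. The trapping region is compact and star-shaped about `0`.

*Forward limits.* Along a solution, `(F₁, F₂)` solves a linear system with nonnegative off-diagonal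
coefficients, so that `F₁ ≤ 0` and `F₂ ≤ 0` persist (`cooperative_nonpos`) and the trapping region
is forward invariant. In it both coordinates increase, so solutions converge to stationary points
in it, which are `0`, the two saddle points and `η`. Off the axes the forward limit can only be `η`.

*Flow lines from the saddle points.* Existence is a compactness argument with orbits starting closer
and closer to the saddle point (`exists_orbit_from_saddlePoint`). Uniqueness rests on
`ratio_le_of_reversed_solution`: if two backward solutions start with equal `j`-th coordinates, the
quotient of their `i`-th coordinates moves away from `1`, again by the linear system argument,
so that distinct orbits have distinct backward limits (`lt_of_tendsto_atBot`).

*The region `Ω₂*`.* No separation theorem for closed curves is needed. The bounding set `C` is a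
union of orbits, so the bounded components of its complement are invariant in both time directions
(`CutoffFlow.flow_mem_regionBoundedBy`); the complement of the star-shaped trapping region has only
unbounded components, so they lie in `Ω₂`. Backward orbits in `Ω₂*` thus converge to `0` or to a
saddle point. The latter is impossible at an interior point, because by `lt_of_tendsto_atBot` a
neighbour of it would have a backward limit beyond the saddle point
(`tendsto_zero_of_mem_interior`).

To have orbits for all times, the field is multiplied by a cut-off function (`CutoffFlow`).
-/

/-! ### Stationary points with positive coordinates -/

/-- The polynomial `F₁` in the rescaled coordinates `x = q₁ Y₁`, `y = q₂ Y₂`; exchanging the roles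
of the two factors gives `F₂`. -/
noncomputable def scaledF (a b x y : ℝ) : ℝ :=
  2 * (a + 2) * x - (4 * a + 6) * x ^ 2 - 4 * b * y ^ 2 - 1 / 2

lemma scaledF_eq_factored (a b x y : ℝ) :
    scaledF a b x y = ((4 * a + 6) * x - 1) * (1 / 2 - x) - 4 * b * y ^ 2 := by
  unfold scaledF; ring

/-- Both polynomials are positive at the corner `(1 / (2 (a + 2)), 1 / (2 (b + 2)))`. -/
lemma scaledF_corner_pos {a b : ℝ} (ha : 1 ≤ a) (hb : 1 ≤ b) :
    0 < scaledF a b (1 / (2 * (a + 2))) (1 / (2 * (b + 2))) := by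
  have h1 : (4 * a + 6) * (1 / (2 * (a + 2))) ^ 2 ≤ 5 / 18 := by
    rw [div_pow, one_pow, mul_one_div, div_le_div_iff₀ (by positivity) (by norm_num)]
    nlinarith
  have h2 : 4 * b * (1 / (2 * (b + 2))) ^ 2 ≤ 1 / 8 := by
    rw [div_pow, one_pow, mul_one_div, div_le_div_iff₀ (by positivity) (by norm_num)]
    nlinarith [sq_nonneg (b - 2)]
  have h3 : 2 * (a + 2) * (1 / (2 * (a + 2))) = 1 := by field_simp
  unfold scaledF
  linarith

lemma lt_half_of_scaledF_eq_zero {a b x y : ℝ} (ha : 1 ≤ a) (hb : 1 ≤ b) (hy : 0 < y)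
    (h : scaledF a b x y = 0) : x < 1 / 2 := by
  rw [scaledF_eq_factored] at h
  have : 0 < 4 * b * y ^ 2 := by positivity
  by_contra hx
  have : ((4 * a + 6) * x - 1) * (1 / 2 - x) ≤ 0 :=
    mul_nonpos_of_nonneg_of_nonpos (by nlinarith) (by linarith)
  linarith

/-- On the branch `X² - Z² = k`, `k ≥ 0`, of a hyperbola the quotient `X / Z` grows as `X`
decreases. -/
lemma mul_le_mul_of_sq_sub_sq_eq {k : ℝ} (hk : 0 ≤ k) (X Z X' Z' : ℝ) (hX : 0 < X) (hZ : 0 < Z)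
    (hX' : 0 < X') (hZ' : 0 < Z') (h : X' < X) (e : X ^ 2 - Z ^ 2 = k) (e' : X' ^ 2 - Z' ^ 2 = k) :
    X * Z' ≤ X' * Z := by
  refine (sq_le_sq₀ (by positivity) (by positivity)).1 ?_
  have h' : X' ^ 2 ≤ X ^ 2 := by gcongr
  have h8 : 0 ≤ k * (X ^ 2 - X' ^ 2) := mul_nonneg hk (by linarith)
  have h9 : Z ^ 2 = X ^ 2 - k := by linarith
  have h10 : Z' ^ 2 = X' ^ 2 - k := by linarith
  rw [mul_pow, mul_pow, h9, h10]
  linarith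

/-- For `b ≤ a` a common zero lies on an increasing branch of the hyperbola `F₁ = F₂`, which is a
convex graph over the `x` axis, and on the graph of a strictly concave quadratic polynomial, so three
common zeros are impossible. -/
lemma not_three_zeros {a b x₁ y₁ x₂ y₂ x₃ y₃ : ℝ} (hb : 1 ≤ b) (hab : b ≤ a)
    (hx₁ : 0 < x₁) (hx : x₁ < x₂) (hx' : x₂ < x₃)
    (hx₃ : x₃ < 1 / 2) (hy₁ : y₁ < 1 / 2) (hy₂ : y₂ < 1 / 2) (hy₃ : y₃ < 1 / 2)
    (h₁ : scaledF a b x₁ y₁ = 0) (k₁ : scaledF b a y₁ x₁ = 0)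
    (h₂ : scaledF a b x₂ y₂ = 0) (k₂ : scaledF b a y₂ x₂ = 0)
    (h₃ : scaledF a b x₃ y₃ = 0) (k₃ : scaledF b a y₃ x₃ = 0) : False := by
  unfold scaledF at *
  -- coordinates centred at the centre of the hyperbola `F₁ = F₂`
  obtain ⟨X₁, hX₁⟩ : ∃ X, X = (a + 2) / 6 - x₁ := ⟨_, rfl⟩
  obtain ⟨X₂, hX₂⟩ : ∃ X, X = (a + 2) / 6 - x₂ := ⟨_, rfl⟩
  obtain ⟨X₃, hX₃⟩ : ∃ X, X = (a + 2) / 6 - x₃ := ⟨_, rfl⟩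
  obtain ⟨Z₁, hZ₁⟩ : ∃ X, X = (b + 2) / 6 - y₁ := ⟨_, rfl⟩
  obtain ⟨Z₂, hZ₂⟩ : ∃ X, X = (b + 2) / 6 - y₂ := ⟨_, rfl⟩
  obtain ⟨Z₃, hZ₃⟩ : ∃ X, X = (b + 2) / 6 - y₃ := ⟨_, rfl⟩
  have pX₁ : 0 < X₁ := by linarith
  have pX₂ : 0 < X₂ := by linarith
  have pX₃ : 0 < X₃ := by linarith
  have pZ₁ : 0 < Z₁ := by linarith
  have pZ₂ : 0 < Z₂ := by linarith
  have pZ₃ : 0 < Z₃ := by linarith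
  obtain ⟨k, hk⟩ : ∃ k, k = ((a + 2) / 6) ^ 2 - ((b + 2) / 6) ^ 2 := ⟨_, rfl⟩
  have hk0 : 0 ≤ k := by rw [hk, sub_nonneg]; gcongr
  have e₁ : X₁ ^ 2 - Z₁ ^ 2 = k := by rw [hX₁, hZ₁, hk]; linarith
  have e₂ : X₂ ^ 2 - Z₂ ^ 2 = k := by rw [hX₂, hZ₂, hk]; linarith
  have e₃ : X₃ ^ 2 - Z₃ ^ 2 = k := by rw [hX₃, hZ₃, hk]; linarith
  have c₁ := mul_le_mul_of_sq_sub_sq_eq hk0 X₁ Z₁ X₂ Z₂ pX₁ pZ₁ pX₂ pZ₂ (by linarith) e₁ e₂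
  have c₂ := mul_le_mul_of_sq_sub_sq_eq hk0 X₁ Z₁ X₃ Z₃ pX₁ pZ₁ pX₃ pZ₃ (by linarith) e₁ e₃
  have c₃ := mul_le_mul_of_sq_sub_sq_eq hk0 X₂ Z₂ X₃ Z₃ pX₂ pZ₂ pX₃ pZ₃ (by linarith) e₂ e₃
  have s₁ : (y₂ - y₁) * (Z₁ + Z₂) = (x₂ - x₁) * (X₁ + X₂) := by
    have : y₂ - y₁ = Z₁ - Z₂ := by linarith
    have h : x₂ - x₁ = X₁ - X₂ := by linarith
    rw [this, h]; linear_combination e₂ - e₁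
  have s₂ : (y₃ - y₂) * (Z₂ + Z₃) = (x₃ - x₂) * (X₂ + X₃) := by
    have : y₃ - y₂ = Z₂ - Z₃ := by linarith
    have h : x₃ - x₂ = X₂ - X₃ := by linarith
    rw [this, h]; linear_combination e₃ - e₂
  -- eliminating `y²` from the two equations leaves a concave quadratic graph over the `x` axis
  obtain ⟨A, hA⟩ : ∃ A, A = 4 * a + 6 + 4 * b := ⟨_, rfl⟩
  obtain ⟨B, hB⟩ : ∃ B, B = 2 * (a + 2) * (1 + 2 * b / 3) := ⟨_, rfl⟩
  obtain ⟨κ, hκ⟩ : ∃ κ, κ = 4 * b * (b + 2) / 3 := ⟨_, rfl⟩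
  have hA0 : 0 < A := by linarith
  have hκ0 : 0 < κ := by rw [hκ]; positivity
  have t₁ : κ * (y₂ - y₁) = (x₂ - x₁) * (B - A * (x₁ + x₂)) := by
    rw [hκ, hA, hB]
    linear_combination (1 + 2 * b / 3) * (h₁ - h₂) - 2 * b / 3 * (k₁ - k₂)
  have t₂ : κ * (y₃ - y₂) = (x₃ - x₂) * (B - A * (x₂ + x₃)) := by
    rw [hκ, hA, hB]
    linear_combination (1 + 2 * b / 3) * (h₂ - h₃) - 2 * b / 3 * (k₂ - k₃)
  have u₁ : κ * (X₁ + X₂) = (B - A * (x₁ + x₂)) * (Z₁ + Z₂) := by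
    apply mul_left_cancel₀ (sub_pos.2 hx).ne'
    linear_combination (-κ) * s₁ + (Z₁ + Z₂) * t₁
  have u₂ : κ * (X₂ + X₃) = (B - A * (x₂ + x₃)) * (Z₂ + Z₃) := by
    apply mul_left_cancel₀ (sub_pos.2 hx').ne'
    linear_combination (-κ) * s₂ + (Z₂ + Z₃) * t₂
  have c : (X₁ + X₂) * (Z₂ + Z₃) ≤ (X₂ + X₃) * (Z₁ + Z₂) := by linarith
  have c' := mul_le_mul_of_nonneg_left c hκ0.le
  rw [← mul_assoc, ← mul_assoc, u₁, u₂] at c'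
  have hZ : 0 < (Z₁ + Z₂) * (Z₂ + Z₃) := by positivity
  have : 0 < A * (x₃ - x₁) * ((Z₁ + Z₂) * (Z₂ + Z₃)) :=
    mul_pos (mul_pos hA0 (by linarith)) hZ
  linarith

lemma eq_of_scaledF_zero {a b x y y' : ℝ} (hb : 1 ≤ b)
    (h : scaledF a b x y = 0) (k : scaledF b a y x = 0)
    (h' : scaledF a b x y' = 0) (k' : scaledF b a y' x = 0) : y = y' := by
  unfold scaledF at *
  have : (4 * b * (b + 2) / 3) * (y - y') = 0 := by
    linear_combination (-(1 + 2 * b / 3)) * (h - h') + 2 * b / 3 * (k - k')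
  have h0 : (4 * b * (b + 2) / 3) ≠ 0 := by positivity
  have := (mul_eq_zero.1 this).resolve_left h0
  linarith

/-- Existence and uniqueness of the two common zeros when `b ≤ a`. The branch of the hyperbola
`F₁ = F₂` through the origin is a graph `x = ψ(y)`; along it `F₂` is negative at both ends of
`[0, 1/2]` and positive where the branch leaves the box with the corner of
`scaledF_corner_pos`. -/
lemma exists_two_zeros_of_le {a b : ℝ} (hb : 1 ≤ b) (hab : b ≤ a) :
    ∃ x₁ y₁ x₂ y₂ : ℝ, 0 < x₁ ∧ 0 < y₁ ∧ x₁ < x₂ ∧ y₁ < y₂ ∧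
      (scaledF a b x₁ y₁ = 0 ∧ scaledF b a y₁ x₁ = 0) ∧
      (scaledF a b x₂ y₂ = 0 ∧ scaledF b a y₂ x₂ = 0) ∧
      x₁ ≤ 1 / (2 * (a + 2)) ∧ y₁ ≤ 1 / (2 * (b + 2)) ∧
      (1 / (2 * (a + 2)) < x₂ ∨ 1 / (2 * (b + 2)) < y₂) ∧
      ∀ x y, 0 < x → 0 < y → scaledF a b x y = 0 → scaledF b a y x = 0 →
        (x = x₁ ∧ y = y₁) ∨ (x = x₂ ∧ y = y₂) := by
  have ha : 1 ≤ a := hb.trans hab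
  obtain ⟨ψ, hψ⟩ : ∃ ψ : ℝ → ℝ, ψ = fun y => (a + 2) / 6 -
    √(((b + 2) / 6 - y) ^ 2 + (((a + 2) / 6) ^ 2 - ((b + 2) / 6) ^ 2)) := ⟨_, rfl⟩
  have hk0 : 0 ≤ ((a + 2) / 6) ^ 2 - ((b + 2) / 6) ^ 2 := by nlinarith
  have hψc : Continuous ψ := by rw [hψ]; fun_prop
  have hψ0 : ψ 0 = 0 := by
    rw [hψ]
    have : (((b + 2) / 6 - 0) ^ 2 + (((a + 2) / 6) ^ 2 - ((b + 2) / 6) ^ 2)) =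
      ((a + 2) / 6) ^ 2 := by ring
    simp only [this]
    rw [Real.sqrt_sq (by linarith)]; ring
  have hψm : StrictMonoOn ψ (Icc 0 (1 / 2)) := by
    intro y hy y' hy' h
    rw [hψ]
    apply sub_lt_sub_left
    apply Real.sqrt_lt_sqrt (by positivity)
    have := hy'.2
    nlinarith
  have hψe : ∀ y, scaledF a b (ψ y) y = scaledF b a y (ψ y) := by
    intro y
    have h := Real.sq_sqrt (show 0 ≤ ((b + 2) / 6 - y) ^ 2 +
      (((a + 2) / 6) ^ 2 - ((b + 2) / 6) ^ 2) by positivity)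
    have h' : ψ y = (a + 2) / 6 - √(((b + 2) / 6 - y) ^ 2 +
      (((a + 2) / 6) ^ 2 - ((b + 2) / 6) ^ 2)) := by rw [hψ]
    have h2 : ((a + 2) / 6 - ψ y) ^ 2 = ((b + 2) / 6 - y) ^ 2 +
      (((a + 2) / 6) ^ 2 - ((b + 2) / 6) ^ 2) := by
      rw [h', sub_sub_cancel, h]
    unfold scaledF
    linear_combination (-6) * h2
  have hP₁ : 1 / (2 * (a + 2)) ≤ 1 / 6 := by
    rw [div_le_div_iff₀ (by positivity) (by norm_num)]; linarith
  have hP₂ : 1 / (2 * (b + 2)) ≤ 1 / 6 := by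
    rw [div_le_div_iff₀ (by positivity) (by norm_num)]; linarith
  have pP₁ : 0 < 1 / (2 * (a + 2)) := by positivity
  have pP₂ : 0 < 1 / (2 * (b + 2)) := by positivity
  have c₁ := scaledF_corner_pos ha hb
  have c₂ := scaledF_corner_pos hb ha
  obtain ⟨P₁, eP₁⟩ : ∃ P, P = 1 / (2 * (a + 2)) := ⟨_, rfl⟩
  obtain ⟨P₂, eP₂⟩ : ∃ P, P = 1 / (2 * (b + 2)) := ⟨_, rfl⟩
  rw [← eP₁] at hP₁ pP₁ c₁ c₂ ⊢
  rw [← eP₂] at hP₂ pP₂ c₁ c₂ ⊢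
  -- the point where the branch leaves the box `[0, P₁] × [0, P₂]`
  obtain ⟨y, hy0, hyP, hyψ, hor, hpos⟩ : ∃ y, 0 < y ∧ y ≤ P₂ ∧ ψ y ≤ P₁ ∧ (y = P₂ ∨ ψ y = P₁) ∧
      0 < scaledF b a y (ψ y) := by
    have hψpos : ∀ y, 0 < y → y ≤ P₂ → 0 < ψ y := by
      intro y h h'
      have := hψm ⟨le_rfl, by norm_num⟩ ⟨h.le, by linarith⟩ h
      rwa [hψ0] at this
    rcases le_total (ψ P₂) P₁ with h | h
    · refine ⟨P₂, pP₂, le_rfl, h, Or.inl rfl, lt_of_lt_of_le c₂ ?_⟩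
      have := hψpos P₂ pP₂ le_rfl
      unfold scaledF
      have : ψ P₂ ^ 2 ≤ P₁ ^ 2 := by gcongr
      nlinarith
    · obtain ⟨y, hy, hyψ⟩ := intermediate_value_Icc pP₂.le hψc.continuousOn
        (show P₁ ∈ Icc (ψ 0) (ψ P₂) from ⟨by rw [hψ0]; exact pP₁.le, h⟩)
      have hy0 : 0 < y := by
        rcases hy.1.eq_or_lt with h | h
        · rw [← h, hψ0] at hyψ; linarith
        · exact h
      refine ⟨y, hy0, hy.2, hyψ.le, Or.inr hyψ, ?_⟩
      rw [← hψe, hyψ]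
      refine lt_of_lt_of_le c₁ ?_
      unfold scaledF
      have : y ^ 2 ≤ P₂ ^ 2 := by gcongr; exact hy.2
      nlinarith
  have hgc : Continuous fun y => scaledF b a y (ψ y) := by unfold scaledF; fun_prop
  have hg0 : scaledF b a 0 (ψ 0) < 0 := by rw [hψ0]; unfold scaledF; norm_num
  have hg1 : scaledF b a (1 / 2) (ψ (1 / 2)) < 0 := by
    have h := hψm ⟨le_rfl, by norm_num⟩ ⟨by norm_num, le_rfl⟩ (show (0 : ℝ) < 1 / 2 by norm_num)
    rw [hψ0] at h
    rw [scaledF_eq_factored]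
    have : 0 < 4 * a * ψ (1 / 2) ^ 2 := by positivity
    linarith
  obtain ⟨y₁, hy₁, z₁⟩ := intermediate_value_Ioo hy0.le hgc.continuousOn
    (show (0 : ℝ) ∈ Ioo _ _ from ⟨hg0, hpos⟩)
  obtain ⟨y₂, hy₂, z₂⟩ := intermediate_value_Ioo' (show y ≤ 1 / 2 by linarith) hgc.continuousOn
    (show (0 : ℝ) ∈ Ioo _ _ from ⟨hg1, hpos⟩)
  simp only at z₁ z₂
  have m₁ : y₁ ∈ Icc (0 : ℝ) (1 / 2) := ⟨hy₁.1.le, by linarith [hy₁.2]⟩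
  have m₂ : y₂ ∈ Icc (0 : ℝ) (1 / 2) := ⟨by linarith [hy₂.1], hy₂.2.le⟩
  have m : y ∈ Icc (0 : ℝ) (1 / 2) := ⟨hy0.le, by linarith⟩
  have hx₁ : 0 < ψ y₁ := by
    have := hψm ⟨le_rfl, by norm_num⟩ m₁ hy₁.1
    rwa [hψ0] at this
  have hl₁ := hψm m₁ m hy₁.2
  have hl₂ := hψm m m₂ hy₂.1
  refine ⟨ψ y₁, y₁, ψ y₂, y₂, hx₁, hy₁.1, hl₁.trans hl₂, hy₁.2.trans hy₂.1,
    ⟨(hψe y₁).trans z₁, z₁⟩, ⟨(hψe y₂).trans z₂, z₂⟩, by linarith, by linarith [hy₁.2], ?_, ?_⟩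
  · rcases hor with h | h
    · right; linarith [hy₂.1]
    · left; linarith
  · intro x v hx hv h k
    have hx' := lt_half_of_scaledF_eq_zero ha hb hv h
    have hv' := lt_half_of_scaledF_eq_zero hb ha hx k
    have w₁ := (hψe y₁).trans z₁
    have w₂ := (hψe y₂).trans z₂
    have n₁ := lt_half_of_scaledF_eq_zero ha hb hy₁.1 w₁
    have n₂ := lt_half_of_scaledF_eq_zero ha hb (by linarith [hy₁.1, hy₁.2, hy₂.1]) w₂
    have l₁ : y₁ < 1 / 2 := by linarith [hy₁.2]
    have l₂ := hy₂.2
    rcases lt_trichotomy x (ψ y₁) with c | c | c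
    · exact (not_three_zeros hb hab hx c (hl₁.trans hl₂) n₂ hv' l₁ l₂ h k w₁ z₁ w₂ z₂).elim
    · subst c
      exact Or.inl ⟨rfl, eq_of_scaledF_zero hb h k w₁ z₁⟩
    · rcases lt_trichotomy x (ψ y₂) with d | d | d
      · exact (not_three_zeros hb hab hx₁ c d n₂ l₁ hv' l₂ w₁ z₁ h k w₂ z₂).elim
      · subst d
        exact Or.inr ⟨rfl, eq_of_scaledF_zero hb h k w₂ z₂⟩
      · exact (not_three_zeros hb hab hx₁ (hl₁.trans hl₂) d hx' l₁ l₂ hv' w₁ z₁ w₂ z₂ h k).elim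

/-! ### Ordinary differential equations -/

lemma HasDerivWithinAt.mono_Ici {E : Type*} [NormedAddCommGroup E] [NormedSpace ℝ E]
    {f : ℝ → E} {f' : E} {I : Set ℝ} {t s : ℝ} (h : HasDerivWithinAt f f' I t)
    (hs : Icc t s ⊆ I) (hts : t < s) : HasDerivWithinAt f f' (Ici t) t :=
  (h.mono hs).mono_of_mem_nhdsWithin (Icc_mem_nhdsGE hts)

lemma HasDerivWithinAt.mono_Iic {E : Type*} [NormedAddCommGroup E] [NormedSpace ℝ E]
    {f : ℝ → E} {f' : E} {I : Set ℝ} {t s : ℝ} (h : HasDerivWithinAt f f' I t)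
    (hs : Icc s t ⊆ I) (hts : s < t) : HasDerivWithinAt f f' (Iic t) t :=
  (h.mono hs).mono_of_mem_nhdsWithin (Icc_mem_nhdsLE hts)

/-- Uniqueness of solutions of a time-dependent equation on an interval, when the field is uniformly
Lipschitz along the two solutions on compact subintervals. -/
lemma ode_eqOn_of_lipschitzOn {E : Type*} [NormedAddCommGroup E] [NormedSpace ℝ E]
    {v : ℝ → E → E} {I : Set ℝ} (hI : I.OrdConnected) {f g : ℝ → E}
    (hv : ∀ a b, Icc a b ⊆ I → ∃ K, ∀ t ∈ Icc a b,
      LipschitzOnWith K (v t) (f '' Icc a b ∪ g '' Icc a b))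
    (hf : ∀ t ∈ I, HasDerivWithinAt f (v t (f t)) I t)
    (hg : ∀ t ∈ I, HasDerivWithinAt g (v t (g t)) I t)
    {t₀ : ℝ} (ht₀ : t₀ ∈ I) (h : f t₀ = g t₀) : EqOn f g I := by
  have cf : ContinuousOn f I := fun t ht => (hf t ht).continuousWithinAt
  have cg : ContinuousOn g I := fun t ht => (hg t ht).continuousWithinAt
  intro t ht
  rcases le_total t₀ t with hle | hle
  · have hsub : Icc t₀ t ⊆ I := hI.out ht₀ ht
    obtain ⟨K, hK⟩ := hv t₀ t hsub
    refine ODE_solution_unique_of_mem_Icc_right (v := v) (K := K)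
      (s := fun _ => f '' Icc t₀ t ∪ g '' Icc t₀ t)
      (fun u hu => hK u (Ico_subset_Icc_self hu)) (cf.mono hsub) (fun u hu => ?_)
      (fun u hu => Or.inl ⟨u, Ico_subset_Icc_self hu, rfl⟩) (cg.mono hsub) (fun u hu => ?_)
      (fun u hu => Or.inr ⟨u, Ico_subset_Icc_self hu, rfl⟩) h ⟨hle, le_rfl⟩
    · exact (hf u (hsub (Ico_subset_Icc_self hu))).mono_Ici
        ((Icc_subset_Icc_left hu.1).trans hsub) hu.2
    · exact (hg u (hsub (Ico_subset_Icc_self hu))).mono_Ici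
        ((Icc_subset_Icc_left hu.1).trans hsub) hu.2
  · have hsub : Icc t t₀ ⊆ I := hI.out ht ht₀
    obtain ⟨K, hK⟩ := hv t t₀ hsub
    refine ODE_solution_unique_of_mem_Icc_left (v := v) (K := K)
      (s := fun _ => f '' Icc t t₀ ∪ g '' Icc t t₀)
      (fun u hu => hK u (Ioc_subset_Icc_self hu)) (cf.mono hsub) (fun u hu => ?_)
      (fun u hu => Or.inl ⟨u, Ioc_subset_Icc_self hu, rfl⟩) (cg.mono hsub) (fun u hu => ?_)
      (fun u hu => Or.inr ⟨u, Ioc_subset_Icc_self hu, rfl⟩) h ⟨le_rfl, hle⟩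
    · exact (hf u (hsub (Ioc_subset_Icc_self hu))).mono_Iic
        ((Icc_subset_Icc_right hu.2).trans hsub) hu.1
    · exact (hg u (hsub (Ioc_subset_Icc_self hu))).mono_Iic
        ((Icc_subset_Icc_right hu.2).trans hsub) hu.1

lemma ode_eqOn_of_locallyLipschitz {E : Type*} [NormedAddCommGroup E] [NormedSpace ℝ E]
    {V : E → E} (hV : LocallyLipschitz V) {I : Set ℝ} (hI : I.OrdConnected) {f g : ℝ → E}
    (hf : ∀ t ∈ I, HasDerivWithinAt f (V (f t)) I t)
    (hg : ∀ t ∈ I, HasDerivWithinAt g (V (g t)) I t)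
    {t₀ : ℝ} (ht₀ : t₀ ∈ I) (h : f t₀ = g t₀) : EqOn f g I := by
  have cf : ContinuousOn f I := fun t ht => (hf t ht).continuousWithinAt
  have cg : ContinuousOn g I := fun t ht => (hg t ht).continuousWithinAt
  refine ode_eqOn_of_lipschitzOn (v := fun _ => V) hI (fun a b hab => ?_) hf hg ht₀ h
  obtain ⟨K, hK⟩ := LocallyLipschitzOn.exists_lipschitzOnWith_of_compact
    ((isCompact_Icc.image_of_continuousOn (cf.mono hab)).union
      (isCompact_Icc.image_of_continuousOn (cg.mono hab))) hV.locallyLipschitzOn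
  exact ⟨K, fun _ _ => hK⟩

/-- A solution of a scalar linear homogeneous equation that vanishes once vanishes always. -/
lemma linear_ode_eq_zero {I : Set ℝ} (hI : I.OrdConnected) {g y : ℝ → ℝ} (hg : ContinuousOn g I)
    (hy : ∀ t ∈ I, HasDerivWithinAt y (g t * y t) I t) {t₀ : ℝ} (ht₀ : t₀ ∈ I) (h : y t₀ = 0) :
    ∀ t ∈ I, y t = 0 := by
  refine ode_eqOn_of_lipschitzOn (v := fun t x => g t * x) (g := fun _ => 0) hI
    (fun a b hab => ?_) hy (fun t _ => by simpa using hasDerivWithinAt_const t I (0 : ℝ)) ht₀ h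
  obtain ⟨M, hM⟩ := isCompact_Icc.exists_bound_of_continuousOn (hg.mono hab)
  refine ⟨M.toNNReal, fun t ht => LipschitzOnWith.of_dist_le_mul fun x _ x' _ => ?_⟩
  rw [Real.dist_eq, Real.dist_eq, ← mul_sub, abs_mul]
  gcongr
  exact (hM t ht).trans (Real.le_coe_toNNReal M)

/-- A solution of a scalar linear homogeneous equation that is positive once is positive always. -/
lemma linear_ode_pos {I : Set ℝ} (hI : I.OrdConnected) {g y : ℝ → ℝ} (hg : ContinuousOn g I)
    (hy : ∀ t ∈ I, HasDerivWithinAt y (g t * y t) I t) {t₀ : ℝ} (ht₀ : t₀ ∈ I) (h : 0 < y t₀) :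
    ∀ t ∈ I, 0 < y t := by
  have cy : ContinuousOn y I := fun t ht => (hy t ht).continuousWithinAt
  intro t ht
  by_contra hn
  obtain ⟨s, hs, hs0⟩ := hI.isPreconnected.intermediate_value ht ht₀ cy ⟨not_lt.1 hn, h.le⟩
  exact h.ne' (linear_ode_eq_zero hI hg hy hs hs0 t₀ ht₀)

lemma hasDerivAt_sq_max_zero (x : ℝ) :
    HasDerivAt (fun x : ℝ => max x 0 ^ 2) (2 * max x 0) x := by
  rcases lt_trichotomy x 0 with h | h | h
  · have : (fun x : ℝ => max x 0 ^ 2) =ᶠ[𝓝 x] fun _ => 0 := by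
      filter_upwards [Iio_mem_nhds h] with y hy
      rw [max_eq_right (le_of_lt hy)]; norm_num
    rw [max_eq_right h.le, mul_zero]
    exact (hasDerivAt_const x (0 : ℝ)).congr_of_eventuallyEq this
  · subst h
    rw [hasDerivAt_iff_isLittleO]
    simp only [max_self, mul_zero, smul_zero, sub_zero, ne_eq, OfNat.ofNat_ne_zero,
      not_false_eq_true, zero_pow]
    refine Asymptotics.IsBigO.trans_isLittleO (g := fun x : ℝ => x ^ 2) ?_ ?_
    · refine Asymptotics.isBigO_of_le _ fun x => ?_
      rw [norm_pow, norm_pow]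
      gcongr
      rcases le_total x 0 with h | h <;> simp [h]
    · simpa using Asymptotics.isLittleO_pow_id (𝕜 := ℝ) one_lt_two
  · have : (fun x : ℝ => max x 0 ^ 2) =ᶠ[𝓝 x] fun x => x ^ 2 := by
      filter_upwards [Ioi_mem_nhds h] with y hy
      rw [max_eq_left (le_of_lt hy)]
    rw [max_eq_left h.le]
    simpa using (hasDerivAt_pow 2 x).congr_of_eventuallyEq this

/-- A linear planar system with nonnegative off-diagonal coefficients preserves the third quadrant.
The quantity `(u⁺)² + (v⁺)²` satisfies a linear differential inequality. -/
lemma cooperative_nonpos {T : ℝ} {u v a b c d : ℝ → ℝ}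
    (ha : ContinuousOn a (Icc 0 T)) (hb : ContinuousOn b (Icc 0 T))
    (hc : ContinuousOn c (Icc 0 T)) (hd : ContinuousOn d (Icc 0 T))
    (hb0 : ∀ t ∈ Icc 0 T, 0 ≤ b t) (hd0 : ∀ t ∈ Icc 0 T, 0 ≤ d t)
    (hu : ∀ t ∈ Icc 0 T, HasDerivWithinAt u (a t * u t + b t * v t) (Icc 0 T) t)
    (hv : ∀ t ∈ Icc 0 T, HasDerivWithinAt v (c t * v t + d t * u t) (Icc 0 T) t)
    (hu0 : u 0 ≤ 0) (hv0 : v 0 ≤ 0) : ∀ t ∈ Icc 0 T, u t ≤ 0 ∧ v t ≤ 0 := by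
  obtain ⟨Ma, hMa⟩ := isCompact_Icc.exists_bound_of_continuousOn ha
  obtain ⟨Mb, hMb⟩ := isCompact_Icc.exists_bound_of_continuousOn hb
  obtain ⟨Mc, hMc⟩ := isCompact_Icc.exists_bound_of_continuousOn hc
  obtain ⟨Md, hMd⟩ := isCompact_Icc.exists_bound_of_continuousOn hd
  obtain ⟨M, hM⟩ : ∃ M, M = 2 * (|Ma| + |Mb| + |Mc| + |Md|) := ⟨_, rfl⟩
  have hs : ∀ t ∈ Icc 0 T, HasDerivWithinAt
      (fun t => (max (u t) 0 ^ 2 + max (v t) 0 ^ 2) * Real.exp (-M * t))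
      ((2 * max (u t) 0 * (a t * u t + b t * v t) + 2 * max (v t) 0 * (c t * v t + d t * u t)) *
        Real.exp (-M * t) +
        (max (u t) 0 ^ 2 + max (v t) 0 ^ 2) * (Real.exp (-M * t) * -M)) (Icc 0 T) t := by
    intro t ht
    refine HasDerivWithinAt.mul (HasDerivWithinAt.add ?_ ?_) ?_
    · exact (hasDerivAt_sq_max_zero (u t)).comp_hasDerivWithinAt t (hu t ht)
    · exact (hasDerivAt_sq_max_zero (v t)).comp_hasDerivWithinAt t (hv t ht)
    · have := ((hasDerivAt_id t).const_mul (-M)).exp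
      simpa using this.hasDerivWithinAt
  have hanti := antitoneOn_of_hasDerivWithinAt_nonpos (convex_Icc 0 T)
    (fun t ht => (hs t ht).continuousWithinAt)
    (fun t ht => (hs t (interior_subset ht)).mono interior_subset) (fun t ht => by
      have ht := interior_subset ht
      have e : ∀ x y : ℝ, max x 0 * y ≤ max x 0 * max y 0 := fun x y =>
        mul_le_mul_of_nonneg_left (le_max_left _ _) (le_max_right _ _)
      have e' : ∀ x : ℝ, max x 0 * x = max x 0 ^ 2 := fun x => by
        rcases le_total x 0 with h | h <;> simp [h, sq]
      have n₁ : 0 ≤ max (u t) 0 := le_max_right _ _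
      have n₂ : 0 ≤ max (v t) 0 := le_max_right _ _
      have q₁ := abs_le.1 ((hMa t ht).trans (le_abs_self _))
      have q₂ := abs_le.1 ((hMb t ht).trans (le_abs_self _))
      have q₃ := abs_le.1 ((hMc t ht).trans (le_abs_self _))
      have q₄ := abs_le.1 ((hMd t ht).trans (le_abs_self _))
      have i₁ := mul_le_mul_of_nonneg_left (e (u t) (v t)) (hb0 t ht)
      have i₂ := mul_le_mul_of_nonneg_left (e (v t) (u t)) (hd0 t ht)
      obtain ⟨p, hp⟩ : ∃ p, p = max (u t) 0 := ⟨_, rfl⟩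
      obtain ⟨r, hr⟩ : ∃ r, r = max (v t) 0 := ⟨_, rfl⟩
      have eu := e' (u t)
      have ev := e' (v t)
      rw [← hp, ← hr] at i₁ i₂ ⊢
      rw [← hp] at n₁ eu
      rw [← hr] at n₂ ev
      have key : 2 * p * (a t * u t + b t * v t) + 2 * r * (c t * v t + d t * u t) -
          M * (p ^ 2 + r ^ 2) ≤ 0 := by
        have a1 : a t * p ^ 2 ≤ |Ma| * p ^ 2 := by gcongr; exact q₁.2
        have a2 : b t * (p * r) ≤ |Mb| * (p * r) :=
          mul_le_mul_of_nonneg_right q₂.2 (mul_nonneg n₁ n₂)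
        have a3 : c t * r ^ 2 ≤ |Mc| * r ^ 2 := by gcongr; exact q₃.2
        have a4 : d t * (r * p) ≤ |Md| * (r * p) :=
          mul_le_mul_of_nonneg_right q₄.2 (mul_nonneg n₂ n₁)
        have a5 : |Mb| * (2 * (p * r)) ≤ |Mb| * (p ^ 2 + r ^ 2) := by
          gcongr; linarith [two_mul_le_add_sq p r]
        have a6 : |Md| * (2 * (p * r)) ≤ |Md| * (p ^ 2 + r ^ 2) := by
          gcongr; linarith [two_mul_le_add_sq p r]
        have a7 : 0 ≤ |Ma| * r ^ 2 := by positivity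
        have a8 : 0 ≤ |Mc| * p ^ 2 := by positivity
        have a9 : 0 ≤ |Mb| * (p ^ 2 + r ^ 2) := by positivity
        have a10 : 0 ≤ |Md| * (p ^ 2 + r ^ 2) := by positivity
        have b1 : p * (a t * u t) = a t * p ^ 2 := by rw [← eu]; ring
        have b2 : r * (c t * v t) = c t * r ^ 2 := by rw [← ev]; ring
        rw [hM]
        linarith
      have := mul_nonpos_of_nonpos_of_nonneg key (Real.exp_pos (-M * t)).le
      linarith)
  intro t ht
  have h0 : (0 : ℝ) ∈ Icc 0 T := ⟨le_rfl, ht.1.trans ht.2⟩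
  have h := hanti h0 ht ht.1
  simp only [max_eq_right hu0, max_eq_right hv0] at h
  have h' : max (u t) 0 ^ 2 + max (v t) 0 ^ 2 ≤ 0 := by
    by_contra hn
    have := mul_pos (not_le.1 hn) (Real.exp_pos (-M * t))
    linarith
  have p₁ : max (u t) 0 = 0 := by nlinarith [sq_nonneg (max (u t) 0), sq_nonneg (max (v t) 0)]
  have p₂ : max (v t) 0 = 0 := by nlinarith [sq_nonneg (max (u t) 0), sq_nonneg (max (v t) 0)]
  exact ⟨max_eq_right_iff.1 p₁, max_eq_right_iff.1 p₂⟩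

/-- If a function and its derivative both converge at infinity, the derivative tends to zero. -/
lemma eq_zero_of_tendsto_of_tendsto_deriv {y y' : ℝ → ℝ} {l c : ℝ}
    (hd : ∀ t, 0 < t → HasDerivAt y (y' t) t) (hy : Tendsto y atTop (𝓝 l))
    (hy' : Tendsto y' atTop (𝓝 c)) : c = 0 := by
  have hmvt : ∀ t : ℝ, ∃ s, t ≤ s ∧ (0 < t → y' s = y (t + 1) - y t) := by
    intro t
    by_cases ht : 0 < t
    · obtain ⟨s, hs, h⟩ := exists_hasDerivAt_eq_slope y y' (show t < t + 1 by linarith)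
        (fun x hx => (hd x (ht.trans_le hx.1)).continuousAt.continuousWithinAt)
        (fun x hx => hd x (ht.trans hx.1))
      exact ⟨s, hs.1.le, fun _ => by rw [h]; simp⟩
    · exact ⟨t, le_rfl, fun h => absurd h ht⟩
  choose s hs hs' using hmvt
  have h1 : Tendsto (fun t => y' (s t)) atTop (𝓝 c) :=
    hy'.comp (tendsto_atTop_mono hs tendsto_id)
  have h2 : Tendsto (fun t => y (t + 1) - y t) atTop (𝓝 (l - l)) :=
    (hy.comp (tendsto_atTop_add_const_right _ 1 tendsto_id)).sub hy
  rw [sub_self] at h2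
  refine tendsto_nhds_unique h1 (h2.congr' ?_)
  filter_upwards [eventually_gt_atTop 0] with t ht
  exact (hs' t ht).symm

/-- A bounded, globally Lipschitz vector field has a complete continuous flow. -/
theorem exists_complete_flow {E : Type*} [NormedAddCommGroup E] [NormedSpace ℝ E]
    [CompleteSpace E] {V : E → E} {K L : NNReal} (hV : LipschitzWith K V) (hL : ∀ x, ‖V x‖ ≤ L) :
    ∃ Φ : E → ℝ → E, (∀ p, Φ p 0 = p) ∧ (∀ p t, HasDerivAt (Φ p) (V (Φ p t)) t) ∧
      (∀ f : ℝ → E, (∀ t, HasDerivAt f (V (f t)) t) → f = Φ (f 0)) ∧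
      ∀ t, Continuous fun p => Φ p t := by
  have huniq : ∀ f g : ℝ → E, (∀ t, HasDerivAt f (V (f t)) t) →
      (∀ t, HasDerivAt g (V (g t)) t) → f 0 = g 0 → f = g := fun f g hf hg h =>
    ODE_solution_unique_univ (v := fun _ => V) (s := fun _ => univ) (K := K) (t₀ := 0)
      (fun _ => hV.lipschitzOnWith) (fun t => ⟨hf t, trivial⟩) (fun t => ⟨hg t, trivial⟩) h
  have hloc : ∀ (p : E) (n : ℕ), ∃ f : ℝ → E, f 0 = p ∧
      ∀ t ∈ Icc (-(n : ℝ)) n, HasDerivWithinAt f (V (f t)) (Icc (-(n : ℝ)) n) t := by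
    intro p n
    have hn : (0 : ℝ) ≤ n := n.cast_nonneg
    have : IsPicardLindelof (fun _ => V) (tmin := -(n : ℝ)) (tmax := n)
        ⟨0, by simp, hn⟩ p (L * n) 0 L K :=
      { lipschitzOnWith := fun _ _ => hV.lipschitzOnWith
        continuousOn := fun _ _ => continuousOn_const
        norm_le := fun _ _ x _ => hL x
        mul_max_le := by simp }
    exact this.exists_eq_forall_mem_Icc_hasDerivWithinAt₀
  choose f hf0 hf using hloc
  -- the local solutions are compatible, hence glue to a global one
  have hcompat : ∀ p (n m : ℕ), n ≤ m → EqOn (f p n) (f p m) (Icc (-(n : ℝ)) n) := by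
    intro p n m hnm
    have hnm' : (n : ℝ) ≤ m := by exact_mod_cast hnm
    have hsub : Icc (-(n : ℝ)) n ⊆ Icc (-(m : ℝ)) m :=
      Icc_subset_Icc (by linarith) hnm'
    exact ode_eqOn_of_locallyLipschitz hV.locallyLipschitz ordConnected_Icc (hf p n)
      (fun t ht => (hf p m t (hsub ht)).mono hsub) (t₀ := 0) (by simp) (by rw [hf0, hf0])
  have hΦ : ∀ p (n : ℕ) t, t ∈ Icc (-(n : ℝ)) n → f p (⌈|t|⌉₊) t = f p n t := by
    intro p n t ht
    have h1 : |t| ≤ n := abs_le.2 ht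
    exact hcompat p _ n (Nat.ceil_le.2 h1) (abs_le.1 (Nat.le_ceil |t|))
  have hder : ∀ p t, HasDerivAt (fun t => f p (⌈|t|⌉₊) t) (V (f p (⌈|t|⌉₊) t)) t := by
    intro p t
    have h1 : |t| < (⌈|t|⌉₊ + 1 : ℕ) := by push_cast; linarith [Nat.le_ceil |t|]
    have h2 := abs_lt.1 h1
    rw [hΦ p _ t ⟨h2.1.le, h2.2.le⟩]
    refine ((hf p _ t ⟨h2.1.le, h2.2.le⟩).hasDerivAt (Icc_mem_nhds h2.1 h2.2)).congr_of_eventuallyEq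
      ?_
    filter_upwards [Icc_mem_nhds h2.1 h2.2] with s hs using hΦ p _ s hs
  refine ⟨fun p t => f p (⌈|t|⌉₊) t, fun p => by simp [hf0], hder,
    fun g hg => huniq _ _ hg (hder _) (by simp [hf0]), fun t => ?_⟩
  -- continuity in the initial value, by Grönwall's inequality in both time directions
  have key : ∀ (W : E → E) (F : E → ℝ → E), LipschitzWith K W → (∀ p, F p 0 = p) →
      (∀ p t, HasDerivAt (F p) (W (F p t)) t) → ∀ t, 0 ≤ t → Continuous fun p => F p t := by
    intro W F hW hF0 hF t ht
    refine (LipschitzWith.of_dist_le_mul (K := (Real.exp (K * t)).toNNReal)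
      fun p p' => ?_).continuous
    have := dist_le_of_trajectories_ODE (v := fun _ => W) (f := F p) (g := F p') (a := 0) (b := t)
      (fun _ => hW) (fun s _ => (hF p s).continuousAt.continuousWithinAt)
      (fun s _ => (hF p s).hasDerivWithinAt)
      (fun s _ => (hF p' s).continuousAt.continuousWithinAt)
      (fun s _ => (hF p' s).hasDerivWithinAt) le_rfl t ⟨ht, le_rfl⟩
    rw [Real.coe_toNNReal _ (Real.exp_pos _).le]
    rw [hF0, hF0, sub_zero] at this
    linarith
  rcases le_total 0 t with ht | ht
  · exact key V _ hV (fun p => by simp [hf0]) hder t ht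
  · have := key (fun x => -V x) (fun p t => f p (⌈|(-t)|⌉₊) (-t)) hV.neg
      (fun p => by simp [hf0]) (fun p t => by
        simpa [Function.comp_def] using (hder p (-t)).scomp t (hasDerivAt_neg t)) (-t) (by linarith)
    simpa using this

/-! ### The vector field and the trapping region -/

lemma fin_two_eq_or {i j : Fin 2} (hij : i ≠ j) (k : Fin 2) : k = i ∨ k = j := by
  revert i j k; decide

lemma fieldF_eq_scaledF (n : Fin 2 → ℕ) (q : Fin 2 → ℝ) {i j : Fin 2} (hij : i ≠ j)
    (Y : Fin 2 → ℝ) : fieldF n q i Y = scaledF (n i) (n j) (q i * Y i) (q j * Y j) := by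
  fin_cases i <;> fin_cases j <;> simp_all [fieldF, energyE, scaledF, Fin.sum_univ_two] <;> ring

lemma continuous_fieldF (n : Fin 2 → ℕ) (q : Fin 2 → ℝ) (i : Fin 2) :
    Continuous (fieldF n q i) := by
  unfold fieldF energyE; fun_prop

lemma contDiff_flowField (n : Fin 2 → ℕ) (q : Fin 2 → ℝ) : ContDiff ℝ 1 (flowField n q) := by
  unfold flowField fieldF energyE; fun_prop

/-- The difference of two values of `F_i`, factored so that the signs of its monotonicity in the
two coordinates are visible. -/
lemma fieldF_sub (n : Fin 2 → ℕ) (q : Fin 2 → ℝ) {i j : Fin 2} (hij : i ≠ j) (Y Z : Fin 2 → ℝ) :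
    fieldF n q i Z - fieldF n q i Y =
      (2 * (n i + 2) * q i - (4 * n i + 6) * q i ^ 2 * (Z i + Y i)) * (Z i - Y i) -
        4 * n j * q j ^ 2 * (Z j + Y j) * (Z j - Y j) := by
  rw [fieldF_eq_scaledF n q hij, fieldF_eq_scaledF n q hij]
  unfold scaledF; ring

/-- The corner of a box in which `F_i` increases in the `i`-th coordinate, and at which `F₁` and
`F₂` are positive. The `i`-th coordinate is where a ray from the origin touches `{F_i = 0}`. -/
noncomputable def boxCorner (n : Fin 2 → ℕ) (q : Fin 2 → ℝ) : Fin 2 → ℝ :=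
  fun i => 1 / (2 * (n i + 2) * q i)

/-- The points of the quadrant with `F₁ ≤ 0` and `F₂ ≤ 0`. -/
def nonposRegion (n : Fin 2 → ℕ) (q : Fin 2 → ℝ) : Set (Fin 2 → ℝ) :=
  {Y | ∀ i, 0 ≤ Y i ∧ fieldF n q i Y ≤ 0}

/-- The part of `nonposRegion` in the box below `boxCorner`; it is the region `Ω₂`. -/
def trappingRegion (n : Fin 2 → ℕ) (q : Fin 2 → ℝ) : Set (Fin 2 → ℝ) :=
  {Y | Y ∈ nonposRegion n q ∧ ∀ i, Y i ≤ boxCorner n q i}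

section
variable {n : Fin 2 → ℕ} {q : Fin 2 → ℝ}

lemma mul_boxCorner (hq : ∀ i, 0 < q i) (i : Fin 2) :
    q i * boxCorner n q i = 1 / (2 * ((n i : ℝ) + 2)) := by
  have := (hq i).ne'
  unfold boxCorner; field_simp

lemma mul_le_of_le_boxCorner (hq : ∀ i, 0 < q i) {i : Fin 2} {x : ℝ} (h : x ≤ boxCorner n q i) :
    2 * ((n i : ℝ) + 2) * (q i * x) ≤ 1 := by
  have h1 := mul_le_mul_of_nonneg_left h (hq i).le
  rw [mul_boxCorner hq, le_div_iff₀ (by positivity)] at h1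
  linarith

lemma one_le_of_boxCorner_le (hq : ∀ i, 0 < q i) {i : Fin 2} {x : ℝ} (h : boxCorner n q i ≤ x) :
    1 ≤ 2 * ((n i : ℝ) + 2) * (q i * x) := by
  have h1 := mul_le_mul_of_nonneg_left h (hq i).le
  rw [mul_boxCorner hq, div_le_iff₀ (by positivity)] at h1
  linarith

lemma boxCorner_pos (hq : ∀ i, 0 < q i) (i : Fin 2) : 0 < boxCorner n q i := by
  have := hq i
  unfold boxCorner; positivity

lemma slope_pos (hq : ∀ i, 0 < q i) {i : Fin 2} {x y : ℝ} (hx : x ≤ boxCorner n q i)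
    (hy : y ≤ boxCorner n q i) :
    0 < 2 * ((n i : ℝ) + 2) * q i - (4 * n i + 6) * q i ^ 2 * (x + y) := by
  have h1 := mul_le_of_le_boxCorner hq hx
  have h2 := mul_le_of_le_boxCorner hq hy
  have h3 : (n i : ℝ) + 2 > 0 := by positivity
  have h4 : q i * (x + y) * (n i + 2) ≤ 1 := by linarith
  have h5 : (4 * (n i : ℝ) + 6) * (q i * (x + y) * (n i + 2)) ≤ 4 * n i + 6 := by
    calc _ ≤ (4 * (n i : ℝ) + 6) * 1 := by gcongr
      _ = _ := by ring
  have h6 : 0 < (n i + 2) * (2 * ((n i : ℝ) + 2) - (4 * n i + 6) * (q i * (x + y))) := by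
    have : (4 * (n i : ℝ) + 6) < 2 * (n i + 2) ^ 2 := by nlinarith [(n i).cast_nonneg (α := ℝ)]
    linarith
  have h7 := pos_of_mul_pos_right h6 h3.le
  have h8 := mul_pos (hq i) h7
  linarith

/-- `F_i` is positive on the face of the box where the `i`-th coordinate is maximal. -/
lemma fieldF_pos_of_eq_boxCorner (hn : ∀ i, 1 ≤ n i) (hq : ∀ i, 0 < q i) {i j : Fin 2}
    (hij : i ≠ j) {Y : Fin 2 → ℝ} (hi : Y i = boxCorner n q i) (h0 : 0 ≤ Y j)
    (hj : Y j ≤ boxCorner n q j) : 0 < fieldF n q i Y := by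
  have h1 : (1 : ℝ) ≤ n i := by exact_mod_cast hn i
  have h2 : (1 : ℝ) ≤ n j := by exact_mod_cast hn j
  have h := scaledF_corner_pos h1 h2
  rw [fieldF_eq_scaledF n q hij, hi, mul_boxCorner hq]
  refine h.trans_le ?_
  rw [← mul_boxCorner hq (n := n) j]
  have h3 : (q j * Y j) ^ 2 ≤ (q j * boxCorner n q j) ^ 2 := by
    have := (hq j).le
    gcongr
  unfold scaledF
  nlinarith

lemma lt_boxCorner_of_mem (hn : ∀ i, 1 ≤ n i) (hq : ∀ i, 0 < q i) {Y : Fin 2 → ℝ}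
    (hY : Y ∈ trappingRegion n q) (i : Fin 2) : Y i < boxCorner n q i := by
  obtain ⟨j, hj⟩ := exists_ne i
  refine (hY.2 i).lt_of_ne fun h => ?_
  have := fieldF_pos_of_eq_boxCorner hn hq hj.symm h (hY.1 j).1 (hY.2 j)
  exact absurd (hY.1 i).2 (not_le.2 this)

lemma isClosed_nonposRegion : IsClosed (nonposRegion n q) := by
  have : nonposRegion n q = ⋂ i, {Y | 0 ≤ Y i} ∩ {Y | fieldF n q i Y ≤ 0} := by
    ext Y; simp [nonposRegion]
  rw [this]
  exact isClosed_iInter fun i => (isClosed_le continuous_const (continuous_apply i)).inter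
    (isClosed_le (continuous_fieldF n q i) continuous_const)

lemma trappingRegion_eq_inter : trappingRegion n q = nonposRegion n q ∩ Iic (boxCorner n q) := by
  ext Y; exact Iff.rfl

lemma isClosed_trappingRegion : IsClosed (trappingRegion n q) := by
  rw [trappingRegion_eq_inter]
  exact isClosed_nonposRegion.inter isClosed_Iic

lemma isCompact_trappingRegion : IsCompact (trappingRegion n q) :=
  (isCompact_Icc (a := (0 : Fin 2 → ℝ)) (b := boxCorner n q)).of_isClosed_subset
    isClosed_trappingRegion fun _ hY => ⟨fun i => (hY.1 i).1, fun i => hY.2 i⟩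

/-- On the near side of the points of tangency of `{F_i = 0}` with rays from the origin, `F_i ≤ 0`
is inherited by shorter vectors. -/
lemma fieldF_smul_nonpos_of_le_one (n : Fin 2 → ℕ) (q : Fin 2 → ℝ) {i : Fin 2} {Y : Fin 2 → ℝ}
    (hF : fieldF n q i Y ≤ 0) (hB : 2 * ((n i : ℝ) + 2) * (q i * Y i) ≤ 1) {t : ℝ} (ht : 0 ≤ t)
    (ht' : t ≤ 1) : fieldF n q i (t • Y) ≤ 0 := by
  obtain ⟨j, hj⟩ := exists_ne i
  rw [fieldF_eq_scaledF n q hj.symm] at hF ⊢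
  simp only [Pi.smul_apply, smul_eq_mul]
  unfold scaledF at *
  have h1 := mul_nonneg (sub_nonneg.2 hB) (mul_nonneg ht (sub_nonneg.2 ht'))
  have h2 := mul_le_mul_of_nonneg_left hF (sq_nonneg t)
  nlinarith [sq_nonneg (1 - t)]

/-- On the far side of the points of tangency, `F_i ≤ 0` is inherited by longer vectors. -/
lemma fieldF_smul_nonpos_of_one_le (n : Fin 2 → ℕ) (q : Fin 2 → ℝ) {i : Fin 2} {Y : Fin 2 → ℝ}
    (hF : fieldF n q i Y ≤ 0) (hB : 1 ≤ 2 * ((n i : ℝ) + 2) * (q i * Y i)) {t : ℝ}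
    (ht : 1 ≤ t) : fieldF n q i (t • Y) ≤ 0 := by
  obtain ⟨j, hj⟩ := exists_ne i
  rw [fieldF_eq_scaledF n q hj.symm] at hF ⊢
  simp only [Pi.smul_apply, smul_eq_mul]
  unfold scaledF at *
  have h1 := mul_nonneg (sub_nonneg.2 hB)
    (mul_nonneg (show 0 ≤ t by linarith) (sub_nonneg.2 ht))
  have h2 := mul_le_mul_of_nonneg_left hF (sq_nonneg t)
  nlinarith [sq_nonneg (1 - t)]

lemma smul_mem_trappingRegion (hq : ∀ i, 0 < q i) {Y : Fin 2 → ℝ} (hY : Y ∈ trappingRegion n q)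
    {t : ℝ} (ht : 0 ≤ t) (ht' : t ≤ 1) : t • Y ∈ trappingRegion n q := by
  refine ⟨fun i => ⟨mul_nonneg ht (hY.1 i).1, ?_⟩, fun i => ?_⟩
  · exact fieldF_smul_nonpos_of_le_one n q (hY.1 i).2 (mul_le_of_le_boxCorner hq (hY.2 i)) ht ht'
  · exact (mul_le_of_le_one_left (hY.1 i).1 ht').trans (hY.2 i)

/-- A set containing a ray that starts at a point has an unbounded component there. -/
lemma not_isBounded_connectedComponentIn {E : Type*} [NormedAddCommGroup E] [NormedSpace ℝ E]
    {S : Set E} {p w : E} (hw : w ≠ 0) (h : ∀ t : ℝ, 0 ≤ t → p + t • w ∈ S) :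
    ¬ Bornology.IsBounded (connectedComponentIn S p) := by
  intro hb
  have hpre : IsPreconnected ((fun t : ℝ => p + t • w) '' Ici 0) :=
    isPreconnected_Ici.image _ (by fun_prop)
  have hsub := hpre.subset_connectedComponentIn (x := p) ⟨0, self_mem_Ici, by simp⟩
    (by rintro _ ⟨t, ht, rfl⟩; exact h t ht)
  obtain ⟨C, hC⟩ := (hb.subset hsub).exists_norm_le
  have hw' : 0 < ‖w‖ := norm_pos_iff.2 hw
  have h1 := hC _ ⟨(|C| + ‖p‖ + 1) / ‖w‖, by simp only [mem_Ici]; positivity, rfl⟩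
  have h2 : ‖((|C| + ‖p‖ + 1) / ‖w‖) • w‖ = |C| + ‖p‖ + 1 := by
    rw [norm_smul, Real.norm_of_nonneg (by positivity)]
    field_simp
  have h3 := norm_sub_norm_le (((|C| + ‖p‖ + 1) / ‖w‖) • w) (-p)
  rw [h2, norm_neg, sub_neg_eq_add, add_comm _ p] at h3
  simp only at h1
  linarith [le_abs_self C]

lemma connectedComponentIn_subset_trappingRegion (hn : ∀ i, 1 ≤ n i) (hq : ∀ i, 0 < q i)
    {p : Fin 2 → ℝ} (hp : p ∈ trappingRegion n q) :
    connectedComponentIn (nonposRegion n q) p ⊆ trappingRegion n q := by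
  have hopen : IsOpen {Y : Fin 2 → ℝ | ∀ i, Y i < boxCorner n q i} := by
    simp only [ofPred_forall]
    exact isOpen_iInter_of_finite fun i => isOpen_lt (continuous_apply i) continuous_const
  have hpre := isPreconnected_connectedComponentIn (F := nonposRegion n q) (x := p)
  have hpc : p ∈ connectedComponentIn (nonposRegion n q) p := mem_connectedComponentIn hp.1
  have hS := connectedComponentIn_subset (nonposRegion n q) p
  intro Y hY
  by_contra hYn
  -- the open sets `Y < corner` and `¬ Y ≤ corner` separate
  obtain ⟨Z, hZ, hZ₁, hZ₂⟩ := hpre _ _ hopen isClosed_trappingRegion.isOpen_compl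
    (fun Z hZ => by
      by_cases h : Z ∈ trappingRegion n q
      · exact Or.inl fun i => lt_boxCorner_of_mem hn hq h i
      · exact Or.inr h)
    ⟨p, hpc, fun i => lt_boxCorner_of_mem hn hq hp i⟩ ⟨Y, hY, hYn⟩
  exact hZ₂ ⟨hS hZ, fun i => (hZ₁ i).le⟩

theorem omegaTwo_eq_trappingRegion (hn : ∀ i, 1 ≤ n i) (hq : ∀ i, 0 < q i) :
    omegaTwo n q = trappingRegion n q := by
  ext p
  constructor
  · rintro ⟨hp, hb⟩
    by_contra hpn
    refine absurd hb ?_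
    by_cases hall : ∀ i, boxCorner n q i ≤ p i
    · -- beyond the corner the ray away from the origin stays in the region
      refine not_isBounded_connectedComponentIn (w := p) (fun h0 => ?_) fun t ht i => ?_
      · have := hall 0
        rw [h0] at this
        exact absurd (boxCorner_pos hq 0) (not_lt.2 this)
      · have e : p + t • p = (1 + t) • p := by rw [add_smul, one_smul]
        rw [e]
        exact ⟨mul_nonneg (by linarith) (hp i).1, fieldF_smul_nonpos_of_one_le n q (hp i).2
          (one_le_of_boxCorner_le hq (hall i)) (by linarith)⟩
    · -- otherwise the ray in the direction of the coordinate exceeding the box does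
      push Not at hall
      obtain ⟨j, hj⟩ := hall
      obtain ⟨i, hij⟩ := exists_ne j
      have hi : boxCorner n q i < p i := by
        by_contra h
        refine hpn ⟨hp, fun k => ?_⟩
        rcases fin_two_eq_or hij k with rfl | rfl
        · exact not_lt.1 h
        · exact hj.le
      have hcorner := fieldF_pos_of_eq_boxCorner (Y := Function.update p i (boxCorner n q i)) hn hq
        hij (by simp) (by simpa [hij.symm] using (hp j).1) (by simpa [hij.symm] using hj.le)
      refine not_isBounded_connectedComponentIn (w := Pi.single i 1) (by simp) fun t ht k => ?_
      have ei : (p + t • (Pi.single i 1 : Fin 2 → ℝ)) i = p i + t := by simp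
      have ej : (p + t • (Pi.single i 1 : Fin 2 → ℝ)) j = p j := by simp [hij.symm]
      have hpi := (hp i).1
      have hpj := (hp j).1
      rcases fin_two_eq_or hij k with rfl | rfl
      · refine ⟨by rw [ei]; linarith, ?_⟩
        have d₁ := fieldF_sub n q hij (Function.update p k (boxCorner n q k)) p
        have d₂ := fieldF_sub n q hij p (p + t • (Pi.single k 1 : Fin 2 → ℝ))
        rw [ei, ej] at d₂
        simp only [Function.update_self, Function.update_of_ne hij.symm] at d₁
        -- the slope of `F_i` between the face of the box and `p` is negative
        have s₁ : 2 * ((n k : ℝ) + 2) * q k - (4 * n k + 6) * q k ^ 2 *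
            (p k + boxCorner n q k) < 0 := by
          by_contra hs
          have := mul_nonneg (not_lt.1 hs) (sub_nonneg.2 hi.le)
          have := (hp k).2
          linarith
        have s₂ : 2 * ((n k : ℝ) + 2) * q k - (4 * n k + 6) * q k ^ 2 *
            (p k + t + p k) ≤ 0 := by
          refine le_trans ?_ s₁.le
          have : boxCorner n q k ≤ p k + t := by linarith
          have h6 : (0 : ℝ) ≤ (4 * n k + 6) * q k ^ 2 := by positivity
          nlinarith
        have := mul_nonpos_of_nonpos_of_nonneg s₂ ht
        have := (hp k).2
        have e : p k + t - p k = t := by ring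
        rw [e] at d₂
        linarith
      · refine ⟨by rw [ej]; exact hpj, ?_⟩
        have d := fieldF_sub n q hij.symm p (p + t • (Pi.single i 1 : Fin 2 → ℝ))
        rw [ei, ej] at d
        have h6 : (0 : ℝ) ≤ 4 * n i * q i ^ 2 * (p i + t + p i) * (p i + t - p i) := by
          have e : p i + t - p i = t := by ring
          rw [e]; positivity
        have := (hp k).2
        linarith
  · intro hp
    exact ⟨hp.1, isCompact_trappingRegion.isBounded.subset
      (connectedComponentIn_subset_trappingRegion hn hq hp)⟩

/-! ### Stationary points and the initial set -/

lemma flowField_eq_zero_iff {Y : Fin 2 → ℝ} :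
    flowField n q Y = 0 ↔ ∀ i, Y i = 0 ∨ fieldF n q i Y = 0 := by
  simp [flowField, funext_iff, -Fin.forall_fin_two]

lemma saddlePoint_self (i : Fin 2) :
    saddlePoint n q i i = 1 / ((4 * (n i : ℝ) + 6) * q i) := by simp [saddlePoint]

lemma saddlePoint_of_ne {i j : Fin 2} (hij : i ≠ j) : saddlePoint n q i j = 0 := by
  simp [saddlePoint, hij.symm]

lemma saddlePoint_self_pos (hq : ∀ i, 0 < q i) (i : Fin 2) : 0 < saddlePoint n q i i := by
  have := hq i
  rw [saddlePoint_self]; positivity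

lemma eq_of_coords_eq {i j : Fin 2} (hij : i ≠ j) {Y Z : Fin 2 → ℝ} (hi : Y i = Z i)
    (hj : Y j = Z j) : Y = Z := by
  ext k
  rcases fin_two_eq_or hij k with rfl | rfl <;> assumption

lemma saddlePoint_self_lt_boxCorner (hq : ∀ i, 0 < q i) (i : Fin 2) :
    saddlePoint n q i i < boxCorner n q i := by
  have := hq i
  rw [saddlePoint_self]
  unfold boxCorner
  apply one_div_lt_one_div_of_lt (by positivity)
  have h0 : (0 : ℝ) ≤ n i := by positivity
  nlinarith

lemma fieldF_of_eq_zero {i j : Fin 2} (hij : i ≠ j) {Y : Fin 2 → ℝ} (hj : Y j = 0) :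
    fieldF n q i Y = ((4 * n i + 6) * (q i * Y i) - 1) * (1 / 2 - q i * Y i) := by
  rw [fieldF_eq_scaledF n q hij, scaledF_eq_factored, hj]; ring

lemma fieldF_saddlePoint_self (hq : ∀ i, 0 < q i) (i : Fin 2) :
    fieldF n q i (saddlePoint n q i) = 0 := by
  obtain ⟨j, hj⟩ := exists_ne i
  have := (hq i).ne'
  rw [fieldF_of_eq_zero hj.symm (saddlePoint_of_ne hj.symm), saddlePoint_self]
  have h : (4 * (n i : ℝ) + 6) * (q i * (1 / ((4 * (n i : ℝ) + 6) * q i))) = 1 := by field_simp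
  rw [h]; ring

lemma flowField_saddlePoint (hq : ∀ i, 0 < q i) (i : Fin 2) :
    flowField n q (saddlePoint n q i) = 0 := by
  rw [flowField_eq_zero_iff]
  intro k
  by_cases h : i = k
  · subst h; exact Or.inr (fieldF_saddlePoint_self hq i)
  · exact Or.inl (saddlePoint_of_ne h)

lemma mem_axisSegment_iff (hq : ∀ i, 0 < q i) {i j : Fin 2} (hij : i ≠ j) {Y : Fin 2 → ℝ} :
    Y ∈ axisSegment n q i ↔ Y j = 0 ∧ 0 ≤ Y i ∧ Y i ≤ saddlePoint n q i i := by
  have hpos := saddlePoint_self_pos (n := n) hq i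
  rw [axisSegment, segment_eq_image]
  constructor
  · rintro ⟨t, ht, rfl⟩
    simp only [smul_zero, zero_add, Pi.smul_apply, smul_eq_mul, saddlePoint_of_ne hij, mul_zero,
      true_and]
    exact ⟨mul_nonneg ht.1 hpos.le, mul_le_of_le_one_left hpos.le ht.2⟩
  · rintro ⟨hj, h0, h1⟩
    refine ⟨Y i / saddlePoint n q i i, ⟨by positivity, (div_le_one hpos).2 h1⟩, ?_⟩
    refine eq_of_coords_eq hij ?_ ?_
    · simp [hpos.ne']
    · simp [saddlePoint_of_ne hij, hj]

lemma le_saddlePoint_of_fieldF_nonpos (hq : ∀ i, 0 < q i) {i j : Fin 2} (hij : i ≠ j)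
    {Y : Fin 2 → ℝ} (hj : Y j = 0) (hY : Y i ≤ boxCorner n q i) :
    fieldF n q i Y ≤ 0 ↔ Y i ≤ saddlePoint n q i i := by
  have h1 := mul_le_of_le_boxCorner hq hY
  have h2 : q i * Y i < 1 / 2 := by
    by_contra h
    have h0 : (0 : ℝ) ≤ n i := by positivity
    nlinarith
  rw [fieldF_of_eq_zero hij hj, saddlePoint_self, le_div_iff₀ (mul_pos (by positivity) (hq i))]
  constructor
  · intro h
    by_contra hn
    have := mul_pos (sub_pos.2 (not_le.1 hn)) (sub_pos.2 h2)
    linarith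
  · intro h
    exact mul_nonpos_of_nonpos_of_nonneg (by linarith) (by linarith)

lemma axisSegment_subset_trappingRegion (hq : ∀ i, 0 < q i) (i : Fin 2) :
    axisSegment n q i ⊆ trappingRegion n q := by
  obtain ⟨j, hj⟩ := exists_ne i
  intro Y hY
  obtain ⟨h1, h2, h3⟩ := (mem_axisSegment_iff hq hj.symm).1 hY
  have hle : Y i ≤ boxCorner n q i := h3.trans (saddlePoint_self_lt_boxCorner hq i).le
  have hF := (le_saddlePoint_of_fieldF_nonpos hq hj.symm h1 hle).2 h3
  refine ⟨fun k => ?_, fun k => ?_⟩ <;> rcases fin_two_eq_or hj k with rfl | rfl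
  · refine ⟨h1.ge, ?_⟩
    rw [fieldF_eq_scaledF n q hj, h1]
    unfold scaledF
    have : (0 : ℝ) ≤ 4 * n i * (q i * Y i) ^ 2 := by positivity
    linarith
  · exact ⟨h2, hF⟩
  · exact h1.trans_le (boxCorner_pos hq k).le
  · exact hle

lemma mem_initialSet_iff (hn : ∀ i, 1 ≤ n i) (hq : ∀ i, 0 < q i) {η Y : Fin 2 → ℝ} :
    Y ∈ initialSet n q η ↔ Y ∈ trappingRegion n q ∧ (∀ i, 0 < Y i) ∧ Y ≠ η := by
  have h01 : (0 : Fin 2) ≠ 1 := by decide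
  unfold initialSet
  rw [omegaTwo_eq_trappingRegion hn hq]
  constructor
  · rintro ⟨hY, hn⟩
    simp only [mem_union, mem_singleton_iff, not_or] at hn
    refine ⟨hY, fun i => ?_, hn.2⟩
    by_contra h
    have h0 : Y i = 0 := le_antisymm (not_lt.1 h) (hY.1 i).1
    have key : ∀ j k : Fin 2, j ≠ k → Y k = 0 → Y ∈ axisSegment n q j := fun j k hjk hk =>
      (mem_axisSegment_iff hq hjk).2 ⟨hk, (hY.1 j).1,
        (le_saddlePoint_of_fieldF_nonpos hq hjk hk (hY.2 j)).1 (hY.1 j).2⟩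
    rcases fin_two_eq_or h01 i with rfl | rfl
    · exact hn.1.2 (key 1 0 h01.symm h0)
    · exact hn.1.1 (key 0 1 h01 h0)
  · rintro ⟨hY, hpos, hne⟩
    refine ⟨hY, ?_⟩
    simp only [mem_union, mem_singleton_iff, not_or]
    refine ⟨⟨fun h => ?_, fun h => ?_⟩, hne⟩
    · exact (hpos 1).ne' ((mem_axisSegment_iff hq h01).1 h).1
    · exact (hpos 0).ne' ((mem_axisSegment_iff hq h01.symm).1 h).1

lemma stationary_cases (hq : ∀ i, 0 < q i) {Y : Fin 2 → ℝ} (hY : Y ∈ trappingRegion n q)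
    (h : flowField n q Y = 0) : Y = 0 ∨ (∃ i, Y = saddlePoint n q i) ∨ Y ∈ einsteinPoints n q := by
  by_cases hpos : ∀ i, 0 < Y i
  · exact Or.inr (Or.inr ⟨hpos, h⟩)
  · push Not at hpos
    obtain ⟨j, hj⟩ := hpos
    have hj0 : Y j = 0 := le_antisymm hj (hY.1 j).1
    obtain ⟨i, hij⟩ := exists_ne j
    rcases flowField_eq_zero_iff.1 h i with hi | hi
    · exact Or.inl (eq_of_coords_eq hij hi hj0)
    · refine Or.inr (Or.inl ⟨i, eq_of_coords_eq hij ?_ (hj0.trans (saddlePoint_of_ne hij).symm)⟩)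
      refine le_antisymm ((le_saddlePoint_of_fieldF_nonpos hq hij hj0 (hY.2 i)).1 hi.le) ?_
      rw [fieldF_of_eq_zero hij hj0] at hi
      have h1 := mul_le_of_le_boxCorner hq (hY.2 i)
      have h2 : q i * Y i < 1 / 2 := by
        by_contra h
        have h0 : (0 : ℝ) ≤ n i := by positivity
        nlinarith
      have h3 := (mul_eq_zero.1 hi).resolve_right (by linarith)
      have h4 := hq i
      rw [saddlePoint_self, div_le_iff₀ (by positivity)]
      linarith

/-- There are exactly two stationary points with positive coordinates; the smaller one lies in the
trapping region and the other one does not. -/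
theorem exists_einsteinPoints (hn : ∀ i, 1 ≤ n i) (hq : ∀ i, 0 < q i) :
    ∃ η ξ : Fin 2 → ℝ, einsteinPoints n q = {η, ξ} ∧ (∀ i, η i < ξ i) ∧
      η ∈ trappingRegion n q ∧ ξ ∉ trappingRegion n q := by
  obtain ⟨i, j, hij, hle⟩ : ∃ i j : Fin 2, i ≠ j ∧ n j ≤ n i := by
    rcases le_total (n 0) (n 1) with h | h
    · exact ⟨1, 0, by decide, h⟩
    · exact ⟨0, 1, by decide, h⟩
  obtain ⟨x₁, y₁, x₂, y₂, hx, hy, hxx, hyy, ⟨z₁, w₁⟩, ⟨z₂, w₂⟩, hP₁, hP₂, hor, huniq⟩ :=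
    exists_two_zeros_of_le (a := n i) (b := n j) (by exact_mod_cast hn j) (by exact_mod_cast hle)
  have hqi := hq i
  have hqj := hq j
  -- a point of the plane from its rescaled coordinates
  obtain ⟨pt, hpti, hptj⟩ : ∃ pt : ℝ → ℝ → Fin 2 → ℝ, (∀ x y, pt x y i = x / q i) ∧
      ∀ x y, pt x y j = y / q j :=
    ⟨fun x y k => if k = i then x / q i else y / q j, fun x y => by simp,
      fun x y => by simp [hij.symm]⟩
  have mi : ∀ x y, q i * pt x y i = x := fun x y => by rw [hpti]; field_simp
  have mj : ∀ x y, q j * pt x y j = y := fun x y => by rw [hptj]; field_simp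
  have hzero : ∀ Y : Fin 2 → ℝ, (∀ k, 0 < Y k) → (flowField n q Y = 0 ↔
      scaledF (n i) (n j) (q i * Y i) (q j * Y j) = 0 ∧
      scaledF (n j) (n i) (q j * Y j) (q i * Y i) = 0) := by
    intro Y hpos
    rw [flowField_eq_zero_iff, ← fieldF_eq_scaledF n q hij, ← fieldF_eq_scaledF n q hij.symm]
    refine ⟨fun h => ⟨(h i).resolve_left (hpos i).ne', (h j).resolve_left (hpos j).ne'⟩,
      fun h k => Or.inr ?_⟩
    rcases fin_two_eq_or hij k with rfl | rfl
    exacts [h.1, h.2]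
  have hpos : ∀ x y, 0 < x → 0 < y → ∀ k, 0 < pt x y k := by
    intro x y hx hy k
    rcases fin_two_eq_or hij k with rfl | rfl
    · rw [hpti]; positivity
    · rw [hptj]; positivity
  have p₁ := hpos x₁ y₁ hx hy
  have p₂ := hpos x₂ y₂ (hx.trans hxx) (hy.trans hyy)
  refine ⟨pt x₁ y₁, pt x₂ y₂, ?_, fun k => ?_, ⟨fun k => ⟨(p₁ k).le, ?_⟩, fun k => ?_⟩,
    fun h => ?_⟩
  · ext Y
    constructor
    · rintro ⟨hYpos, hY⟩
      obtain ⟨h, k⟩ := (hzero Y hYpos).1 hY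
      have key : ∀ x y, q i * Y i = x → q j * Y j = y → Y = pt x y := fun x y h1 h2 =>
        eq_of_coords_eq hij (by rw [hpti, ← h1]; field_simp) (by rw [hptj, ← h2]; field_simp)
      rcases huniq _ _ (mul_pos hqi (hYpos i)) (mul_pos hqj (hYpos j)) h k with ⟨h1, h2⟩ | ⟨h1, h2⟩
      · exact Or.inl (key _ _ h1 h2)
      · exact Or.inr (key _ _ h1 h2)
    · rintro (rfl | rfl)
      · exact ⟨p₁, (hzero _ p₁).2 ⟨by rwa [mi, mj], by rwa [mi, mj]⟩⟩
      · exact ⟨p₂, (hzero _ p₂).2 ⟨by rwa [mi, mj], by rwa [mi, mj]⟩⟩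
  · rcases fin_two_eq_or hij k with rfl | rfl
    · rw [hpti, hpti]; gcongr
    · rw [hptj, hptj]; gcongr
  · rcases fin_two_eq_or hij k with rfl | rfl
    · rw [fieldF_eq_scaledF n q hij, mi, mj, z₁]
    · rw [fieldF_eq_scaledF n q hij.symm, mi, mj, w₁]
  · refine le_of_mul_le_mul_left ?_ (hq k)
    rw [mul_boxCorner hq]
    rcases fin_two_eq_or hij k with rfl | rfl
    · rwa [mi]
    · rwa [mj]
  · have hi := mul_le_mul_of_nonneg_left (h.2 i) hqi.le
    have hj := mul_le_mul_of_nonneg_left (h.2 j) hqj.le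
    rw [mul_boxCorner hq, mi] at hi
    rw [mul_boxCorner hq, mj] at hj
    rcases hor with h | h <;> linarith

end

/-! ### Invariance and monotonicity along solutions -/

section
variable {n : Fin 2 → ℕ} {q : Fin 2 → ℝ}

lemma hasDerivWithinAt_coord {c : ℝ → ℝ} {Y : ℝ → Fin 2 → ℝ} {I : Set ℝ}
    (hY : ∀ t ∈ I, HasDerivWithinAt Y (c t • flowField n q (Y t)) I t) (i : Fin 2) :
    ∀ t ∈ I, HasDerivWithinAt (fun t => Y t i) (-(c t * fieldF n q i (Y t)) * Y t i) I t := by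
  intro t ht
  have := hasDerivWithinAt_pi.1 (hY t ht) i
  have e : (c t • flowField n q (Y t)) i = -(c t * fieldF n q i (Y t)) * Y t i := by
    simp only [Pi.smul_apply, flowField, smul_eq_mul]; ring
  rwa [e] at this

lemma continuousOn_of_hasDerivWithinAt {E : Type*} [NormedAddCommGroup E] [NormedSpace ℝ E]
    {Y Y' : ℝ → E} {I : Set ℝ} (hY : ∀ t ∈ I, HasDerivWithinAt Y (Y' t) I t) : ContinuousOn Y I :=
  fun t ht => (hY t ht).continuousWithinAt

lemma continuousOn_rate {c : ℝ → ℝ} {Y : ℝ → Fin 2 → ℝ} {I : Set ℝ} (hc : ContinuousOn c I)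
    (hY : ContinuousOn Y I) (i : Fin 2) :
    ContinuousOn (fun t => -(c t * fieldF n q i (Y t))) I :=
  (hc.mul ((continuous_fieldF n q i).comp_continuousOn hY)).neg

lemma coord_pos {c : ℝ → ℝ} {Y : ℝ → Fin 2 → ℝ} {I : Set ℝ} (hI : I.OrdConnected)
    (hc : ContinuousOn c I) (hY : ∀ t ∈ I, HasDerivWithinAt Y (c t • flowField n q (Y t)) I t)
    {i : Fin 2} {t₀ : ℝ} (ht₀ : t₀ ∈ I) (h : 0 < Y t₀ i) : ∀ t ∈ I, 0 < Y t i :=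
  linear_ode_pos hI (continuousOn_rate hc (continuousOn_of_hasDerivWithinAt hY) i)
    (hasDerivWithinAt_coord hY i) ht₀ h

lemma coord_eq_zero {c : ℝ → ℝ} {Y : ℝ → Fin 2 → ℝ} {I : Set ℝ} (hI : I.OrdConnected)
    (hc : ContinuousOn c I) (hY : ∀ t ∈ I, HasDerivWithinAt Y (c t • flowField n q (Y t)) I t)
    {i : Fin 2} {t₀ : ℝ} (ht₀ : t₀ ∈ I) (h : Y t₀ i = 0) : ∀ t ∈ I, Y t i = 0 :=
  linear_ode_eq_zero hI (continuousOn_rate hc (continuousOn_of_hasDerivWithinAt hY) i)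
    (hasDerivWithinAt_coord hY i) ht₀ h

lemma coord_nonneg {c : ℝ → ℝ} {Y : ℝ → Fin 2 → ℝ} {I : Set ℝ} (hI : I.OrdConnected)
    (hc : ContinuousOn c I) (hY : ∀ t ∈ I, HasDerivWithinAt Y (c t • flowField n q (Y t)) I t)
    {i : Fin 2} {t₀ : ℝ} (ht₀ : t₀ ∈ I) (h : 0 ≤ Y t₀ i) (t : ℝ) (ht : t ∈ I) : 0 ≤ Y t i := by
  rcases h.eq_or_lt with h | h
  · exact (coord_eq_zero hI hc hY ht₀ h.symm t ht).ge
  · exact (coord_pos hI hc hY ht₀ h t ht).le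

/-- Along a solution the pair `(F₁, F₂)` solves a linear system with nonnegative off-diagonal
coefficients. -/
lemma hasDerivWithinAt_fieldF {c : ℝ → ℝ} {Y : ℝ → Fin 2 → ℝ} {I : Set ℝ}
    (hY : ∀ t ∈ I, HasDerivWithinAt Y (c t • flowField n q (Y t)) I t) {i j : Fin 2}
    (hij : i ≠ j) : ∀ t ∈ I, HasDerivWithinAt (fun t => fieldF n q i (Y t))
      (-(c t * Y t i * (2 * (n i + 2) * q i - 2 * (4 * n i + 6) * q i ^ 2 * Y t i)) *
        fieldF n q i (Y t) + 8 * n j * q j ^ 2 * c t * Y t j ^ 2 * fieldF n q j (Y t)) I t := by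
  intro t ht
  have di := hasDerivWithinAt_coord hY i t ht
  have dj := hasDerivWithinAt_coord hY j t ht
  have e : (fun t => fieldF n q i (Y t)) = fun t =>
      2 * ((n i : ℝ) + 2) * q i * Y t i - (4 * n i + 6) * q i ^ 2 * Y t i ^ 2 -
        4 * n j * q j ^ 2 * Y t j ^ 2 - 1 / 2 := by
    ext t
    rw [fieldF_eq_scaledF n q hij]
    unfold scaledF; ring
  rw [e]
  refine ((((di.const_mul (2 * ((n i : ℝ) + 2) * q i)).sub
    ((di.pow 2).const_mul ((4 * n i + 6) * q i ^ 2))).sub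
    ((dj.pow 2).const_mul (4 * n j * q j ^ 2))).sub_const (1 / 2)).congr_deriv ?_
  push_cast
  ring

lemma mem_nonposRegion_of_solution {c : ℝ → ℝ} {Y : ℝ → Fin 2 → ℝ} {T : ℝ}
    (hc : ContinuousOn c (Icc 0 T)) (hc0 : ∀ t ∈ Icc 0 T, 0 ≤ c t)
    (hY : ∀ t ∈ Icc 0 T, HasDerivWithinAt Y (c t • flowField n q (Y t)) (Icc 0 T) t)
    (h0 : Y 0 ∈ nonposRegion n q) : ∀ t ∈ Icc 0 T, Y t ∈ nonposRegion n q := by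
  intro t ht i
  have h0T : (0 : ℝ) ∈ Icc 0 T := ⟨le_rfl, ht.1.trans ht.2⟩
  obtain ⟨j, hj⟩ := exists_ne i
  have hij := hj.symm
  have cY := continuousOn_of_hasDerivWithinAt hY
  have cc : ∀ k, ContinuousOn (fun t => Y t k) (Icc 0 T) := fun k =>
    (continuous_apply k).comp_continuousOn cY
  refine ⟨coord_nonneg ordConnected_Icc hc hY h0T (h0 i).1 t ht, ?_⟩
  have := cooperative_nonpos (T := T)
    (u := fun t => fieldF n q i (Y t)) (v := fun t => fieldF n q j (Y t))
    (a := fun t => -(c t * Y t i * (2 * (n i + 2) * q i - 2 * (4 * n i + 6) * q i ^ 2 * Y t i)))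
    (b := fun t => 8 * n j * q j ^ 2 * c t * Y t j ^ 2)
    (c := fun t => -(c t * Y t j * (2 * (n j + 2) * q j - 2 * (4 * n j + 6) * q j ^ 2 * Y t j)))
    (d := fun t => 8 * n i * q i ^ 2 * c t * Y t i ^ 2)
    (by have := cc i; fun_prop) (by have := cc j; fun_prop) (by have := cc j; fun_prop)
    (by have := cc i; fun_prop)
    (fun t ht => by have := hc0 t ht; positivity) (fun t ht => by have := hc0 t ht; positivity)
    (hasDerivWithinAt_fieldF hY hij) (hasDerivWithinAt_fieldF hY hj) (h0 i).2 (h0 j).2 t ht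
  exact this.1

/-- The trapping region is forward invariant: a solution stays in `nonposRegion`, hence in the same
component of it. -/
theorem mem_trappingRegion_of_solution (hn : ∀ i, 1 ≤ n i) (hq : ∀ i, 0 < q i) {c : ℝ → ℝ}
    {Y : ℝ → Fin 2 → ℝ} (hc : ContinuousOn c (Ici 0)) (hc0 : ∀ t ∈ Ici 0, 0 ≤ c t)
    (hY : ∀ t ∈ Ici 0, HasDerivWithinAt Y (c t • flowField n q (Y t)) (Ici 0) t)
    (h0 : Y 0 ∈ trappingRegion n q) : ∀ t, 0 ≤ t → Y t ∈ trappingRegion n q := by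
  intro T hT
  have hsub : Icc 0 T ⊆ Ici 0 := Icc_subset_Ici_self
  have hmem := mem_nonposRegion_of_solution (hc.mono hsub) (fun t ht => hc0 t (hsub ht))
    (fun t ht => (hY t (hsub ht)).mono hsub) h0.1
  have hpre : IsPreconnected (Y '' Icc 0 T) :=
    isPreconnected_Icc.image Y ((continuousOn_of_hasDerivWithinAt hY).mono hsub)
  have := hpre.subset_connectedComponentIn (x := Y 0) ⟨0, ⟨le_rfl, hT⟩, rfl⟩
    (by rintro _ ⟨t, ht, rfl⟩; exact hmem t ht)
  exact connectedComponentIn_subset_trappingRegion hn hq h0 (this ⟨T, ⟨hT, le_rfl⟩, rfl⟩)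

lemma IsSolutionOn.smul_one {Y : ℝ → Fin 2 → ℝ} {I : Set ℝ} (h : IsSolutionOn n q Y I) :
    ∀ t ∈ I, HasDerivWithinAt Y ((1 : ℝ) • flowField n q (Y t)) I t :=
  fun t ht => by simpa only [one_smul] using h t ht

lemma IsSolutionOn.comp_neg {Y : ℝ → Fin 2 → ℝ} (h : IsSolutionOn n q Y (Iic 0)) :
    ∀ t ∈ Ici 0, HasDerivWithinAt (fun t => Y (-t)) ((-1 : ℝ) • flowField n q (Y (-t))) (Ici 0) t :=
  fun t ht => by
    have := (h (-t) (by simpa using ht)).scomp t (hasDerivAt_neg t).hasDerivWithinAt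
      (s := Ici 0) (fun s hs => by simpa using hs)
    simpa [Function.comp_def] using this

lemma IsSolutionOn.comp_add {Y : ℝ → Fin 2 → ℝ} {I J : Set ℝ} (h : IsSolutionOn n q Y I) (s : ℝ)
    (hJ : ∀ t ∈ J, t + s ∈ I) : IsSolutionOn n q (fun t => Y (t + s)) J := fun t ht => by
  have := (h (t + s) (hJ t ht)).scomp t ((hasDerivAt_id t).add_const s).hasDerivWithinAt
    (s := J) hJ
  simpa [Function.comp_def] using this

lemma IsSolutionOn.eqOn {Y Z : ℝ → Fin 2 → ℝ} {I : Set ℝ} (hI : I.OrdConnected)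
    (hY : IsSolutionOn n q Y I) (hZ : IsSolutionOn n q Z I) {t₀ : ℝ} (ht₀ : t₀ ∈ I)
    (h : Y t₀ = Z t₀) : EqOn Y Z I :=
  ode_eqOn_of_locallyLipschitz (contDiff_flowField n q).locallyLipschitz hI hY hZ ht₀ h

/-- In the trapping region all coordinates of a solution increase. -/
lemma IsSolutionOn.monotoneOn_coord {Y : ℝ → Fin 2 → ℝ} {I : Set ℝ} (hI : Convex ℝ I)
    (hY : IsSolutionOn n q Y I) (hK : ∀ t ∈ I, Y t ∈ trappingRegion n q) (i : Fin 2) :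
    MonotoneOn (fun t => Y t i) I := by
  have h := hasDerivWithinAt_coord hY.smul_one i
  refine monotoneOn_of_hasDerivWithinAt_nonneg hI (continuousOn_of_hasDerivWithinAt h)
    (fun t ht => (h t (interior_subset ht)).mono interior_subset) fun t ht => ?_
  have := (hK t (interior_subset ht)).1 i
  rw [one_mul]
  exact mul_nonneg (neg_nonneg.2 this.2) this.1

/-- A solution staying in the trapping region converges to a stationary point in forward time. -/
theorem IsSolutionOn.exists_tendsto_atTop {Y : ℝ → Fin 2 → ℝ} (hY : IsSolutionOn n q Y (Ici 0))
    (hK : ∀ t, 0 ≤ t → Y t ∈ trappingRegion n q) :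
    ∃ l ∈ trappingRegion n q, flowField n q l = 0 ∧ Tendsto Y atTop (𝓝 l) ∧
      ∀ t, 0 ≤ t → ∀ i, Y t i ≤ l i := by
  have hmono := fun i => hY.monotoneOn_coord (convex_Ici 0) hK i
  have hlim : ∀ i, ∃ l, Tendsto (fun t => Y t i) atTop (𝓝 l) ∧ ∀ t, 0 ≤ t → Y t i ≤ l := by
    intro i
    have hm : Monotone fun t => Y (max t 0) i := fun s t hst =>
      hmono i (mem_Ici.2 (le_max_right s 0)) (mem_Ici.2 (le_max_right t 0)) (max_le_max_right 0 hst)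
    have hb : BddAbove (range fun t => Y (max t 0) i) :=
      ⟨boxCorner n q i, by rintro _ ⟨t, rfl⟩; exact (hK _ (le_max_right _ _)).2 i⟩
    refine ⟨_, (tendsto_atTop_ciSup hm hb).congr' ?_, fun t ht => ?_⟩
    · filter_upwards [eventually_ge_atTop 0] with t ht
      rw [max_eq_left ht]
    · have := le_ciSup hb t
      rwa [max_eq_left ht] at this
  choose l hl hle using hlim
  have hY' : Tendsto Y atTop (𝓝 l) := tendsto_pi_nhds.2 hl
  refine ⟨l, isClosed_trappingRegion.mem_of_tendsto hY' ?_, ?_, hY', fun t ht i => hle i t ht⟩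
  · filter_upwards [eventually_ge_atTop 0] with t ht using hK t ht
  · ext i
    have hV := (contDiff_flowField n q).continuous.continuousAt.tendsto.comp hY'
    refine eq_zero_of_tendsto_of_tendsto_deriv (y' := fun t => flowField n q (Y t) i)
      (fun t ht => ?_) (hl i) (tendsto_pi_nhds.1 hV i)
    exact hasDerivAt_pi.1 ((hY t ht.le).hasDerivAt (Ici_mem_nhds ht)) i

/-- A solution staying in the trapping region converges to a stationary point in backward time. -/
theorem IsSolutionOn.exists_tendsto_atBot {Y : ℝ → Fin 2 → ℝ} (hY : IsSolutionOn n q Y (Iic 0))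
    (hK : ∀ t ≤ 0, Y t ∈ trappingRegion n q) :
    ∃ l ∈ trappingRegion n q, flowField n q l = 0 ∧ Tendsto Y atBot (𝓝 l) ∧
      ∀ t ≤ 0, ∀ i, l i ≤ Y t i := by
  have hmono := fun i => hY.monotoneOn_coord (convex_Iic 0) hK i
  have hlim : ∀ i, ∃ l, Tendsto (fun t => Y t i) atBot (𝓝 l) ∧ ∀ t ≤ 0, l ≤ Y t i := by
    intro i
    have hm : Monotone fun t => Y (min t 0) i := fun s t hst =>
      hmono i (mem_Iic.2 (min_le_right s 0)) (mem_Iic.2 (min_le_right t 0)) (min_le_min_right 0 hst)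
    have hb : BddBelow (range fun t => Y (min t 0) i) :=
      ⟨0, by rintro _ ⟨t, rfl⟩; exact ((hK _ (min_le_right _ _)).1 i).1⟩
    refine ⟨_, (tendsto_atBot_ciInf hm hb).congr' ?_, fun t ht => ?_⟩
    · filter_upwards [eventually_le_atBot 0] with t ht
      rw [min_eq_left ht]
    · have := ciInf_le hb t
      rwa [min_eq_left ht] at this
  choose l hl hle using hlim
  have hY' : Tendsto Y atBot (𝓝 l) := tendsto_pi_nhds.2 hl
  refine ⟨l, isClosed_trappingRegion.mem_of_tendsto hY' ?_, ?_, hY', fun t ht i => hle i t ht⟩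
  · filter_upwards [eventually_le_atBot 0] with t ht using hK t ht
  · ext i
    have hV := (contDiff_flowField n q).continuous.continuousAt.tendsto.comp
      (hY'.comp tendsto_neg_atTop_atBot)
    have := eq_zero_of_tendsto_of_tendsto_deriv (y' := fun t => -flowField n q (Y (-t)) i)
      (fun t ht => ?_) ((hl i).comp tendsto_neg_atTop_atBot) (tendsto_pi_nhds.1 hV i).neg
    · simpa using this
    · have := hasDerivAt_pi.1 ((hY.comp_neg t ht.le).hasDerivAt (Ici_mem_nhds ht)) i
      simpa [Function.comp_def] using this

/-! ### Separation of orbits in backward time -/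

/-- The quotient of the `i`-th coordinates of two solutions, in reversed time. -/
lemma hasDerivWithinAt_ratio {Y Z : ℝ → Fin 2 → ℝ} {I : Set ℝ} {i j : Fin 2} (hij : i ≠ j)
    (hY : ∀ t ∈ I, HasDerivWithinAt Y ((-1 : ℝ) • flowField n q (Y t)) I t)
    (hZ : ∀ t ∈ I, HasDerivWithinAt Z ((-1 : ℝ) • flowField n q (Z t)) I t)
    (hYpos : ∀ t ∈ I, ∀ k, 0 < Y t k) :
    ∀ t ∈ I, HasDerivWithinAt (fun t => Z t i / Y t i)
      (Z t i * (2 * (n i + 2) * q i - (4 * n i + 6) * q i ^ 2 * (Z t i + Y t i)) *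
          (Z t i / Y t i - 1) +
        Z t i / Y t i * (4 * n j * q j ^ 2 * (Z t j + Y t j)) * Y t j *
          (1 - Z t j / Y t j)) I t := by
  intro t ht
  have pi' := (hYpos t ht i).ne'
  have pj := (hYpos t ht j).ne'
  have dY := hasDerivWithinAt_coord hY i t ht
  have dZ := hasDerivWithinAt_coord hZ i t ht
  have h := fieldF_sub n q hij (Y t) (Z t)
  refine (dZ.div dY pi').congr_deriv ?_
  have e : fieldF n q i (Z t) = fieldF n q i (Y t) +
      ((2 * (n i + 2) * q i - (4 * n i + 6) * q i ^ 2 * (Z t i + Y t i)) * (Z t i - Y t i) -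
        4 * n j * q j ^ 2 * (Z t j + Y t j) * (Z t j - Y t j)) := by linarith
  rw [e]
  field_simp
  ring

/-- If two orbits have the same `j`-th coordinate at time zero, the quotient of their other
coordinates is at least as far from `1` at all earlier times; stated in reversed time, where the pair
`(1 - Zᵢ / Yᵢ, Zⱼ / Yⱼ - 1)` solves a linear system with nonnegative off-diagonal coefficients. -/
theorem ratio_le_of_reversed_solution (hq : ∀ i, 0 < q i) {Y Z : ℝ → Fin 2 → ℝ} {i j : Fin 2}
    (hij : i ≠ j)
    (rY : ∀ t ∈ Ici 0, HasDerivWithinAt Y ((-1 : ℝ) • flowField n q (Y t)) (Ici 0) t)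
    (rZ : ∀ t ∈ Ici 0, HasDerivWithinAt Z ((-1 : ℝ) • flowField n q (Z t)) (Ici 0) t)
    (hYpos : ∀ k, 0 < Y 0 k) (hZpos : ∀ k, 0 < Z 0 k)
    (hYle : ∀ t, 0 ≤ t → Y t i ≤ boxCorner n q i) (hZle : ∀ t, 0 ≤ t → Z t i ≤ boxCorner n q i)
    (hj : Y 0 j = Z 0 j) (hi : Y 0 i ≤ Z 0 i) :
    ∀ t, 0 ≤ t → Z 0 i / Y 0 i ≤ Z t i / Y t i := by
  have h0 : (0 : ℝ) ∈ Ici (0 : ℝ) := self_mem_Ici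
  have pY : ∀ t ∈ Ici (0 : ℝ), ∀ k, 0 < Y t k := fun t ht k =>
    coord_pos (t₀ := 0) ordConnected_Ici continuousOn_const rY h0 (hYpos k) t ht
  have pZ : ∀ t ∈ Ici (0 : ℝ), ∀ k, 0 < Z t k := fun t ht k =>
    coord_pos (t₀ := 0) ordConnected_Ici continuousOn_const rZ h0 (hZpos k) t ht
  have di := hasDerivWithinAt_ratio hij rY rZ pY
  have dj := hasDerivWithinAt_ratio hij.symm rY rZ pY
  have cY : ∀ k, ContinuousOn (fun t => Y t k) (Ici 0) := fun k =>
    (continuous_apply k).comp_continuousOn (continuousOn_of_hasDerivWithinAt rY)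
  have cZ : ∀ k, ContinuousOn (fun t => Z t k) (Ici 0) := fun k =>
    (continuous_apply k).comp_continuousOn (continuousOn_of_hasDerivWithinAt rZ)
  have cR : ∀ k, ContinuousOn (fun t => Z t k / Y t k) (Ici 0) := fun k =>
    (cZ k).div (cY k) fun t ht => (pY t ht k).ne'
  have du : ∀ t ∈ Ici (0 : ℝ), HasDerivWithinAt (fun t => 1 - Z t i / Y t i)
      (Z t i * (2 * (n i + 2) * q i - (4 * n i + 6) * q i ^ 2 * (Z t i + Y t i)) *
        (1 - Z t i / Y t i) +
      Z t i / Y t i * (4 * n j * q j ^ 2 * (Z t j + Y t j)) * Y t j *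
        (Z t j / Y t j - 1)) (Ici 0) t := fun t ht =>
    ((di t ht).const_sub 1).congr_deriv (by ring)
  have dv : ∀ t ∈ Ici (0 : ℝ), HasDerivWithinAt (fun t => Z t j / Y t j - 1)
      (Z t j * (2 * (n j + 2) * q j - (4 * n j + 6) * q j ^ 2 * (Z t j + Y t j)) *
        (Z t j / Y t j - 1) +
      Z t j / Y t j * (4 * n i * q i ^ 2 * (Z t i + Y t i)) * Y t i *
        (1 - Z t i / Y t i)) (Ici 0) t := fun t ht => (dj t ht).sub_const 1
  have key : ∀ t ∈ Ici (0 : ℝ), 1 - Z t i / Y t i ≤ 0 ∧ Z t j / Y t j - 1 ≤ 0 := by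
    intro T hT
    have hsub : Icc 0 T ⊆ Ici 0 := Icc_subset_Ici_self
    have cYi := (cY i).mono hsub
    have cYj := (cY j).mono hsub
    have cZi := (cZ i).mono hsub
    have cZj := (cZ j).mono hsub
    have cRi := (cR i).mono hsub
    have cRj := (cR j).mono hsub
    refine cooperative_nonpos (T := T) ?_ ?_ ?_ ?_ ?_ ?_
      (fun t ht => (du t (hsub ht)).mono hsub) (fun t ht => (dv t (hsub ht)).mono hsub) ?_ ?_ T
      ⟨hT, le_rfl⟩
    · fun_prop
    · fun_prop
    · fun_prop
    · fun_prop
    · intro t ht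
      have := pY t ht.1 i; have := pY t ht.1 j; have := pZ t ht.1 i; have := pZ t ht.1 j
      positivity
    · intro t ht
      have := pY t ht.1 i; have := pY t ht.1 j; have := pZ t ht.1 i; have := pZ t ht.1 j
      positivity
    · rw [sub_nonpos, one_le_div (hYpos i)]
      exact hi
    · rw [← hj, div_self (hYpos j).ne', sub_self]
  have hanti : AntitoneOn (fun t => 1 - Z t i / Y t i) (Ici 0) := by
    refine antitoneOn_of_hasDerivWithinAt_nonpos (convex_Ici 0)
      (continuousOn_of_hasDerivWithinAt du)
      (fun t ht => (du t (interior_subset ht)).mono interior_subset) fun t ht => ?_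
    have ht := interior_subset ht
    have s := slope_pos hq (hZle _ ht) (hYle _ ht)
    have := pY t ht i; have := pY t ht j; have := pZ t ht i; have := pZ t ht j
    exact add_nonpos (mul_nonpos_of_nonneg_of_nonpos (by positivity) (key t ht).1)
      (mul_nonpos_of_nonneg_of_nonpos (by positivity) (key t ht).2)
  intro t ht
  have := hanti h0 ht ht
  simp only at this
  linarith

end

/-! ### A complete flow extending the dynamics in the trapping region -/

/-- The complete flow of the vector field multiplied by a cut-off function that is `1` on the
trapping region: inside the region its orbits are solutions of the original system. -/
structure CutoffFlow (n : Fin 2 → ℕ) (q : Fin 2 → ℝ) where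
  /-- The position at time `t` of the orbit through `p` at time `0`. -/
  flow : (Fin 2 → ℝ) → ℝ → Fin 2 → ℝ
  /-- The cut-off function. -/
  cutoff : (Fin 2 → ℝ) → ℝ
  continuous_cutoff : Continuous cutoff
  cutoff_nonneg : ∀ x, 0 ≤ cutoff x
  cutoff_eq_one : ∀ x ∈ trappingRegion n q, cutoff x = 1
  flow_zero : ∀ p, flow p 0 = p
  hasDerivAt_flow : ∀ p t, HasDerivAt (flow p) (cutoff (flow p t) • flowField n q (flow p t)) t
  flow_unique : ∀ f : ℝ → Fin 2 → ℝ, (∀ t, HasDerivAt f (cutoff (f t) • flowField n q (f t)) t) →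
    f = flow (f 0)
  continuous_flow : ∀ t, Continuous fun p => flow p t

theorem nonempty_cutoffFlow (n : Fin 2 → ℕ) (q : Fin 2 → ℝ) : Nonempty (CutoffFlow n q) := by
  obtain ⟨R, hR⟩ := (isCompact_trappingRegion (n := n) (q := q)).isBounded.subset_closedBall 0
  let ρ : ContDiffBump (0 : Fin 2 → ℝ) := ⟨|R| + 1, |R| + 2, by positivity, by linarith⟩
  have hV : ContDiff ℝ 1 fun x => ρ x • flowField n q x := ρ.contDiff.smul (contDiff_flowField n q)
  have hsupp : HasCompactSupport fun x => ρ x • flowField n q x :=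
    ρ.hasCompactSupport.smul_right
  obtain ⟨K, hK⟩ := ContDiff.lipschitzWith_of_hasCompactSupport hsupp hV one_ne_zero
  obtain ⟨L, hL⟩ := hsupp.exists_bound_of_continuous hV.continuous
  obtain ⟨Φ, h0, hd, hu, hc⟩ := exists_complete_flow (L := L.toNNReal) hK
    fun x => (hL x).trans (Real.le_coe_toNNReal L)
  refine ⟨⟨Φ, ρ, ρ.continuous, fun x => ρ.nonneg, fun x hx => ?_, h0, hd, hu, hc⟩⟩
  refine ρ.one_of_mem_closedBall (Metric.closedBall_subset_closedBall ?_ (hR hx))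
  change R ≤ |R| + 1
  linarith [le_abs_self R]

namespace CutoffFlow

variable {n : Fin 2 → ℕ} {q : Fin 2 → ℝ} (Φ : CutoffFlow n q)

lemma flow_flow (p : Fin 2 → ℝ) (s t : ℝ) : Φ.flow (Φ.flow p s) t = Φ.flow p (t + s) := by
  have := Φ.flow_unique (fun t => Φ.flow p (t + s)) fun t => by
    simpa [Function.comp_def] using
      (Φ.hasDerivAt_flow p (t + s)).scomp t ((hasDerivAt_id t).add_const s)
  simp only [zero_add] at this
  exact (congrFun this t).symm

lemma continuous_orbit (p : Fin 2 → ℝ) : Continuous (Φ.flow p) :=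
  continuous_iff_continuousAt.2 fun t => (Φ.hasDerivAt_flow p t).continuousAt

lemma flow_eq_self {p : Fin 2 → ℝ} (hp : flowField n q p = 0) (t : ℝ) : Φ.flow p t = p := by
  have := Φ.flow_unique (fun _ => p) fun t => by simpa [hp] using hasDerivAt_const t p
  exact (congrFun this t).symm

lemma eq_of_flow_eq {p e : Fin 2 → ℝ} (he : flowField n q e = 0) {t : ℝ} (h : Φ.flow p t = e) :
    p = e := by
  have h1 := Φ.flow_flow p t (-t)
  rw [h, neg_add_cancel, Φ.flow_zero, Φ.flow_eq_self he] at h1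
  exact h1.symm

lemma hasDerivWithinAt_flow (p : Fin 2 → ℝ) (I : Set ℝ) : ∀ t ∈ I,
    HasDerivWithinAt (Φ.flow p) (Φ.cutoff (Φ.flow p t) • flowField n q (Φ.flow p t)) I t :=
  fun t _ => (Φ.hasDerivAt_flow p t).hasDerivWithinAt

lemma continuous_cutoff_orbit (p : Fin 2 → ℝ) : Continuous fun t => Φ.cutoff (Φ.flow p t) :=
  Φ.continuous_cutoff.comp (Φ.continuous_orbit p)

lemma isSolutionOn {p : Fin 2 → ℝ} {I : Set ℝ} (h : ∀ t ∈ I, Φ.flow p t ∈ trappingRegion n q) :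
    IsSolutionOn n q (Φ.flow p) I := fun t ht => by
  have := Φ.hasDerivWithinAt_flow p I t ht
  rwa [Φ.cutoff_eq_one _ (h t ht), one_smul] at this

lemma flow_mem_trappingRegion (hn : ∀ i, 1 ≤ n i) (hq : ∀ i, 0 < q i) {p : Fin 2 → ℝ}
    (hp : p ∈ trappingRegion n q) {t : ℝ} (ht : 0 ≤ t) : Φ.flow p t ∈ trappingRegion n q :=
  mem_trappingRegion_of_solution hn hq (Φ.continuous_cutoff_orbit p).continuousOn
    (fun _ _ => Φ.cutoff_nonneg _) (Φ.hasDerivWithinAt_flow p _)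
    (by rwa [Φ.flow_zero]) t ht

lemma flow_pos {p : Fin 2 → ℝ} {i : Fin 2} (h : 0 < p i) (t : ℝ) : 0 < Φ.flow p t i :=
  coord_pos ordConnected_univ (Φ.continuous_cutoff_orbit p).continuousOn
    (Φ.hasDerivWithinAt_flow p univ) (mem_univ 0) (by rwa [Φ.flow_zero]) t (mem_univ t)

lemma flow_nonneg {p : Fin 2 → ℝ} {i : Fin 2} (h : 0 ≤ p i) (t : ℝ) : 0 ≤ Φ.flow p t i :=
  coord_nonneg ordConnected_univ (Φ.continuous_cutoff_orbit p).continuousOn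
    (Φ.hasDerivWithinAt_flow p univ) (mem_univ 0) (by rwa [Φ.flow_zero]) t (mem_univ t)

lemma flow_eq_zero {p : Fin 2 → ℝ} {i : Fin 2} (h : p i = 0) (t : ℝ) : Φ.flow p t i = 0 :=
  coord_eq_zero ordConnected_univ (Φ.continuous_cutoff_orbit p).continuousOn
    (Φ.hasDerivWithinAt_flow p univ) (mem_univ 0) (by rwa [Φ.flow_zero]) t (mem_univ t)

/-- The axis segments are invariant in both time directions, because an orbit on the axis cannot
cross the stationary end point. -/
lemma flow_mem_axisSegment (hq : ∀ i, 0 < q i) {i : Fin 2} {p : Fin 2 → ℝ}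
    (hp : p ∈ axisSegment n q i) (t : ℝ) : Φ.flow p t ∈ axisSegment n q i := by
  obtain ⟨j, hj⟩ := exists_ne i
  have hp' := (mem_axisSegment_iff hq hj.symm).1 hp
  refine (mem_axisSegment_iff hq hj.symm).2
    ⟨Φ.flow_eq_zero hp'.1 t, Φ.flow_nonneg hp'.2.1 t, ?_⟩
  by_contra hn
  have hc : Continuous fun t => Φ.flow p t i := (continuous_apply i).comp (Φ.continuous_orbit p)
  obtain ⟨s, -, hs⟩ := isPreconnected_univ.intermediate_value (mem_univ 0) (mem_univ t)
    hc.continuousOn (show saddlePoint n q i i ∈ Icc (Φ.flow p 0 i) (Φ.flow p t i) from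
      ⟨by rw [Φ.flow_zero]; exact hp'.2.2, (not_le.1 hn).le⟩)
  have h1 : Φ.flow p s = saddlePoint n q i := eq_of_coords_eq hj.symm hs
    ((Φ.flow_eq_zero hp'.1 s).trans (saddlePoint_of_ne hj.symm).symm)
  have h2 := Φ.eq_of_flow_eq (flowField_saddlePoint hq i) h1
  rw [h2, Φ.flow_eq_self (flowField_saddlePoint hq i)] at hn
  exact hn le_rfl

end CutoffFlow

/-! ### Limits of solutions -/

/-- `η` is the only stationary point with positive coordinates in the trapping region. -/
structure IsInnerPoint (n : Fin 2 → ℕ) (q : Fin 2 → ℝ) (η : Fin 2 → ℝ) : Prop where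
  mem : η ∈ trappingRegion n q
  pos : ∀ i, 0 < η i
  stationary : flowField n q η = 0
  unique : ∀ Y ∈ trappingRegion n q, Y ∈ einsteinPoints n q → Y = η

section
variable {n : Fin 2 → ℕ} {q : Fin 2 → ℝ} {η : Fin 2 → ℝ}

lemma IsSolutionOn.mem_trappingRegion (hn : ∀ i, 1 ≤ n i) (hq : ∀ i, 0 < q i) {Y : ℝ → Fin 2 → ℝ}
    (hY : IsSolutionOn n q Y (Ici 0)) (h0 : Y 0 ∈ trappingRegion n q) {t : ℝ} (ht : 0 ≤ t) :
    Y t ∈ trappingRegion n q :=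
  mem_trappingRegion_of_solution hn hq (c := fun _ => 1) continuousOn_const
    (fun _ _ => zero_le_one) hY.smul_one h0 t ht

theorem IsSolutionOn.tendsto_innerPoint (hn : ∀ i, 1 ≤ n i) (hq : ∀ i, 0 < q i)
    (hη : IsInnerPoint n q η) {Y : ℝ → Fin 2 → ℝ} (hY : IsSolutionOn n q Y (Ici 0))
    (h0 : Y 0 ∈ initialSet n q η) : Tendsto Y atTop (𝓝 η) ∧ ∀ i, Y 0 i ≤ η i := by
  obtain ⟨hK, hpos, -⟩ := (mem_initialSet_iff hn hq).1 h0
  obtain ⟨l, hl, hs, hlim, hle⟩ := hY.exists_tendsto_atTop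
    fun t ht => hY.mem_trappingRegion hn hq hK ht
  have hlpos : ∀ i, 0 < l i := fun i => (hpos i).trans_le (hle 0 le_rfl i)
  obtain rfl := hη.unique l hl ⟨hlpos, hs⟩
  exact ⟨hlim, hle 0 le_rfl⟩

lemma le_innerPoint (hn : ∀ i, 1 ≤ n i) (hq : ∀ i, 0 < q i) (hη : IsInnerPoint n q η)
    (Φ : CutoffFlow n q) {p : Fin 2 → ℝ} (hp : p ∈ initialSet n q η) (i : Fin 2) : p i ≤ η i := by
  have hK := ((mem_initialSet_iff hn hq).1 hp).1
  have := (Φ.isSolutionOn (I := Ici 0) fun t ht => Φ.flow_mem_trappingRegion hn hq hK ht)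
    |>.tendsto_innerPoint hn hq hη (by rwa [Φ.flow_zero])
  have h := this.2 i
  rwa [Φ.flow_zero] at h

/-- The possible backward limits of solutions staying in the trapping region. -/
lemma IsSolutionOn.tendsto_atBot_cases (hn : ∀ i, 1 ≤ n i) (hq : ∀ i, 0 < q i)
    (hη : IsInnerPoint n q η) (Φ : CutoffFlow n q) {Y : ℝ → Fin 2 → ℝ}
    (hY : IsSolutionOn n q Y (Iic 0)) (hK : ∀ t ≤ 0, Y t ∈ trappingRegion n q)
    (h0 : Y 0 ∈ initialSet n q η) :
    ∃ l, Tendsto Y atBot (𝓝 l) ∧ (l = 0 ∨ ∃ i, l = saddlePoint n q i) := by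
  obtain ⟨l, hl, hs, hlim, hle⟩ := hY.exists_tendsto_atBot hK
  refine ⟨l, hlim, ?_⟩
  rcases stationary_cases hq hl hs with h | h | h
  · exact Or.inl h
  · exact Or.inr h
  · -- the coordinates increase, so that the limit `η` would force `Y 0 = η`
    obtain rfl := hη.unique l hl h
    refine absurd ?_ ((mem_initialSet_iff hn hq).1 h0).2.2
    ext i
    exact le_antisymm (le_innerPoint hn hq hη Φ h0 i) (hle 0 le_rfl i)

lemma flow_mem_initialSet (hn : ∀ i, 1 ≤ n i) (hq : ∀ i, 0 < q i) (hη : IsInnerPoint n q η)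
    (Φ : CutoffFlow n q) {p : Fin 2 → ℝ} (hp : p ∈ initialSet n q η) {t : ℝ}
    (ht : Φ.flow p t ∈ trappingRegion n q) : Φ.flow p t ∈ initialSet n q η := by
  obtain ⟨-, hpos, hne⟩ := (mem_initialSet_iff hn hq).1 hp
  exact (mem_initialSet_iff hn hq).2 ⟨ht, fun i => Φ.flow_pos (hpos i) t,
    fun h => hne (Φ.eq_of_flow_eq hη.stationary h)⟩

/-- Two solutions on the same horizontal or vertical line at time zero whose orbits are distinct
have distinct backward limits, ordered in the same way. -/
lemma lt_of_tendsto_atBot (hq : ∀ i, 0 < q i) {Y Z : ℝ → Fin 2 → ℝ} {i j : Fin 2} (hij : i ≠ j)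
    (hY : IsSolutionOn n q Y (Iic 0)) (hZ : IsSolutionOn n q Z (Iic 0))
    (hYpos : ∀ k, 0 < Y 0 k) (hZpos : ∀ k, 0 < Z 0 k)
    (hYle : ∀ t ≤ 0, Y t i ≤ boxCorner n q i) (hZle : ∀ t ≤ 0, Z t i ≤ boxCorner n q i)
    (hj : Y 0 j = Z 0 j) (hi : Y 0 i < Z 0 i) {l m : Fin 2 → ℝ} (hl : Tendsto Y atBot (𝓝 l))
    (hm : Tendsto Z atBot (𝓝 m)) (hpos : 0 < l i) : l i < m i := by
  have h := ratio_le_of_reversed_solution hq hij hY.comp_neg hZ.comp_neg (by simpa using hYpos)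
    (by simpa using hZpos) (fun t ht => hYle _ (by simpa using ht))
    (fun t ht => hZle _ (by simpa using ht)) (by simpa using hj) (by simpa using hi.le)
  simp only [neg_zero] at h
  have hlim : Tendsto (fun t => Z (-t) i / Y (-t) i) atTop (𝓝 (m i / l i)) :=
    ((tendsto_pi_nhds.1 hm i).comp tendsto_neg_atTop_atBot).div
      ((tendsto_pi_nhds.1 hl i).comp tendsto_neg_atTop_atBot) hpos.ne'
  have hge : Z 0 i / Y 0 i ≤ m i / l i := ge_of_tendsto hlim (by
    filter_upwards [eventually_ge_atTop 0] with t ht using h t ht)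
  have h1 : 1 < Z 0 i / Y 0 i := (one_lt_div (hYpos i)).2 hi
  exact (one_lt_div hpos).1 (h1.trans_le hge)

/-! ### The flow lines emanating from the saddle points -/

/-- The point at height `ε` above the saddle point on the `i`-th axis lies in the trapping region
for small `ε`. -/
lemma eventually_update_mem (hq : ∀ i, 0 < q i) {i j : Fin 2} (hij : i ≠ j) :
    ∀ᶠ ε in 𝓝[>] (0 : ℝ), Function.update (saddlePoint n q i) j ε ∈ trappingRegion n q := by
  have hc : Continuous fun ε : ℝ => Function.update (saddlePoint n q i) j ε := by fun_prop
  have hFj : fieldF n q j (saddlePoint n q i) < 0 := by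
    rw [fieldF_eq_scaledF n q hij.symm, saddlePoint_of_ne hij]
    unfold scaledF
    have : 0 ≤ 4 * (n i : ℝ) * (q i * saddlePoint n q i i) ^ 2 := by positivity
    linarith
  have h0 : Function.update (saddlePoint n q i) j 0 = saddlePoint n q i :=
    eq_of_coords_eq hij (by simp [hij]) (by simp [saddlePoint_of_ne hij])
  have h1 : ∀ᶠ ε in 𝓝[>] (0 : ℝ), fieldF n q j (Function.update (saddlePoint n q i) j ε) < 0 := by
    refine eventually_nhdsWithin_of_eventually_nhds ?_
    refine ((continuous_fieldF n q j).comp hc).continuousAt.eventually_lt continuousAt_const ?_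
    simpa [h0] using hFj
  have h2 : ∀ᶠ ε in 𝓝[>] (0 : ℝ), ε < boxCorner n q j :=
    eventually_nhdsWithin_of_eventually_nhds (Iio_mem_nhds (boxCorner_pos hq j))
  filter_upwards [h1, h2, self_mem_nhdsWithin] with ε hε₁ hε₂ hε₀
  have hε₀ : 0 < ε := hε₀
  refine ⟨fun k => ?_, fun k => ?_⟩ <;> rcases fin_two_eq_or hij k with rfl | rfl
  · refine ⟨by simpa [hij] using (saddlePoint_self_pos hq k).le, ?_⟩
    have := fieldF_sub n q hij (saddlePoint n q k) (Function.update (saddlePoint n q k) j ε)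
    rw [fieldF_saddlePoint_self hq, Function.update_self, Function.update_of_ne hij,
      saddlePoint_of_ne hij] at this
    have h3 : 0 ≤ 4 * (n j : ℝ) * q j ^ 2 * (ε + 0) * (ε - 0) := by
      rw [sub_zero, add_zero]; positivity
    linarith
  · exact ⟨by simpa using hε₀.le, hε₁.le⟩
  · simpa [hij] using (saddlePoint_self_lt_boxCorner hq k).le
  · simpa using hε₂.le

/-- There is an orbit in the trapping region emanating from the saddle point on the `i`-th axis.
The orbits starting at points that approach the saddle point from inside the region all cross the
line where the `j`-th coordinate is `η_j / 2`; a limit point of the crossing points lies on the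
desired orbit. -/
theorem exists_orbit_from_saddlePoint (hn : ∀ i, 1 ≤ n i) (hq : ∀ i, 0 < q i)
    (hη : IsInnerPoint n q η) (Φ : CutoffFlow n q) (i : Fin 2) :
    ∃ p ∈ initialSet n q η, (∀ t, Φ.flow p t ∈ trappingRegion n q) ∧
      Tendsto (Φ.flow p) atBot (𝓝 (saddlePoint n q i)) := by
  obtain ⟨j, hji⟩ := exists_ne i
  have hij := hji.symm
  have ha := saddlePoint_self_pos (n := n) hq i
  have hηj := hη.pos j
  have hmono : ∀ p ∈ trappingRegion n q, ∀ k, MonotoneOn (fun t => Φ.flow p t k) (Ici 0) :=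
    fun p hp k => (Φ.isSolutionOn fun t ht =>
      Φ.flow_mem_trappingRegion hn hq hp ht).monotoneOn_coord (convex_Ici 0)
      (fun t ht => Φ.flow_mem_trappingRegion hn hq hp ht) k
  -- every orbit starting close to the saddle point crosses the line
  have hcross : ∀ᶠ ε in 𝓝[>] (0 : ℝ),
      Function.update (saddlePoint n q i) j ε ∈ trappingRegion n q ∧ ∃ T, 0 ≤ T ∧
        Φ.flow (Function.update (saddlePoint n q i) j ε) T j = η j / 2 := by
    filter_upwards [eventually_update_mem hq hij, self_mem_nhdsWithin,
      eventually_nhdsWithin_of_eventually_nhds (Iio_mem_nhds (half_pos hηj))] with ε hK hε0 hε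
    have hε0 : 0 < ε := hε0
    refine ⟨hK, ?_⟩
    have hD : Function.update (saddlePoint n q i) j ε ∈ initialSet n q η := by
      refine (mem_initialSet_iff hn hq).2 ⟨hK, fun k => ?_, fun h => ?_⟩
      · rcases fin_two_eq_or hij k with rfl | rfl
        · simpa [hij] using ha
        · simpa using hε0
      · have := congrFun h j
        rw [Function.update_self] at this
        have : ε < η j / 2 := hε
        linarith
    have hlim := ((Φ.isSolutionOn (I := Ici 0) fun t ht =>
      Φ.flow_mem_trappingRegion hn hq hK ht).tendsto_innerPoint hn hq hη
        (by rwa [Φ.flow_zero])).1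
    obtain ⟨t, ht, ht0⟩ := (((tendsto_pi_nhds.1 hlim j).eventually
      (Ioi_mem_nhds (half_lt_self hηj))).and (eventually_ge_atTop 0)).exists
    obtain ⟨T, hT, hT'⟩ := intermediate_value_Icc ht0
      ((continuous_apply j).comp (Φ.continuous_orbit _)).continuousOn
      (show η j / 2 ∈ Icc _ _ from
        ⟨by simpa [Φ.flow_zero] using (show ε < η j / 2 from hε).le, le_of_lt ht⟩)
    exact ⟨T, hT.1, hT'⟩
  obtain ⟨ε, hεlim, hε⟩ := exists_seq_forall_of_frequently hcross.frequently
  choose hεK T hT0 hT using hε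
  obtain ⟨p, hpK, φ, hφ, hplim⟩ := isCompact_trappingRegion.tendsto_subseq
    fun k => Φ.flow_mem_trappingRegion hn hq (hεK k) (hT0 k)
  have hpj : p j = η j / 2 := by
    refine tendsto_nhds_unique (tendsto_pi_nhds.1 hplim j) ?_
    simp only [Function.comp_apply, hT]
    exact tendsto_const_nhds
  -- the orbits stay close to the saddle point for a long time, so the crossing times tend to `∞`
  have hTs : ∀ s, ∀ᶠ k in atTop, s ≤ T k := by
    intro s
    have h0 : Tendsto (fun k => Function.update (saddlePoint n q i) j (ε k)) atTop
        (𝓝 (saddlePoint n q i)) := by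
      have hc : Continuous fun ε : ℝ => Function.update (saddlePoint n q i) j ε := by fun_prop
      have := (hc.tendsto 0).comp (hεlim.mono_right nhdsWithin_le_nhds)
      rwa [show Function.update (saddlePoint n q i) j 0 = saddlePoint n q i from
        eq_of_coords_eq hij (by simp [hij]) (by simp [saddlePoint_of_ne hij])] at this
    have h1 := ((Φ.continuous_flow (max s 0)).tendsto _).comp h0
    rw [Φ.flow_eq_self (flowField_saddlePoint hq i)] at h1
    have h2 := tendsto_pi_nhds.1 h1 j
    rw [saddlePoint_of_ne hij] at h2
    filter_upwards [h2.eventually (Iio_mem_nhds (half_pos hηj))] with k hk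
    by_contra hlt
    have := hmono _ (hεK k) j (hT0 k) (mem_Ici.2 (le_max_right s 0))
      ((not_le.1 hlt).le.trans (le_max_left s 0))
    simp only [hT] at this
    exact absurd (show Φ.flow _ (max s 0) j < η j / 2 from hk) (not_lt.2 this)
  have hback : ∀ s, 0 ≤ s → Φ.flow p (-s) ∈ trappingRegion n q ∩
      {Y | saddlePoint n q i i ≤ Y i} := by
    intro s hs
    have hclosed : IsClosed (trappingRegion n q ∩ {Y | saddlePoint n q i i ≤ Y i}) :=
      isClosed_trappingRegion.inter (isClosed_le continuous_const (continuous_apply i))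
    refine hclosed.mem_of_tendsto (((Φ.continuous_flow (-s)).tendsto p).comp hplim) ?_
    filter_upwards [hφ.tendsto_atTop.eventually (hTs s)] with k hk
    have hk' : 0 ≤ -s + T (φ k) := by linarith
    simp only [Function.comp_apply, Φ.flow_flow]
    refine ⟨Φ.flow_mem_trappingRegion hn hq (hεK _) hk', ?_⟩
    have := hmono _ (hεK (φ k)) i self_mem_Ici hk' hk'
    simpa [Φ.flow_zero, hij] using this
  have hpi : saddlePoint n q i i ≤ p i := by
    have := (hback 0 le_rfl).2
    simpa [Φ.flow_zero] using this
  have hpD : p ∈ initialSet n q η := by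
    refine (mem_initialSet_iff hn hq).2 ⟨hpK, fun k => ?_, fun h => ?_⟩
    · rcases fin_two_eq_or hij k with rfl | rfl
      · exact ha.trans_le hpi
      · rw [hpj]; exact half_pos hηj
    · rw [h] at hpj; linarith
  have hK : ∀ t, Φ.flow p t ∈ trappingRegion n q := fun t => by
    rcases le_total 0 t with ht | ht
    · exact Φ.flow_mem_trappingRegion hn hq hpK ht
    · simpa using (hback (-t) (by linarith)).1
  refine ⟨p, hpD, hK, ?_⟩
  obtain ⟨l, hl, hcases⟩ := (Φ.isSolutionOn (I := Iic 0) fun t _ => hK t).tendsto_atBot_cases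
    hn hq hη Φ (fun t _ => hK t) (by rwa [Φ.flow_zero])
  have hli : saddlePoint n q i i ≤ l i := by
    refine ge_of_tendsto (tendsto_pi_nhds.1 hl i) ?_
    filter_upwards [eventually_le_atBot 0] with t ht
    simpa using (hback (-t) (by linarith)).2
  rcases hcases with rfl | ⟨k, rfl⟩
  · exact absurd ha (not_lt.2 hli)
  · rcases fin_two_eq_or hij k with rfl | rfl
    · exact hl
    · rw [saddlePoint_of_ne hij.symm] at hli
      exact absurd ha (not_lt.2 hli)

/-- A solution with the same backward limit as a flow line `γ` from the saddle point is a time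
translate of `γ`. -/
theorem eq_translate_of_tendsto_saddlePoint (hn : ∀ i, 1 ≤ n i) (hq : ∀ i, 0 < q i) {i : Fin 2}
    {γ Z : ℝ → Fin 2 → ℝ} (hγ : IsSolutionOn n q γ univ) (hγD : ∀ u, γ u ∈ initialSet n q η)
    (hγlim : Tendsto γ atBot (𝓝 (saddlePoint n q i))) (hZ : IsSolutionOn n q Z (Iic 0))
    (hZ0 : Z 0 ∈ initialSet n q η) (hZlim : Tendsto Z atBot (𝓝 (saddlePoint n q i))) :
    ∃ s : ℝ, ∀ u ≤ 0, Z u = γ (u + s) := by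
  obtain ⟨j, hji⟩ := exists_ne i
  have hij := hji.symm
  have hγK : ∀ u, γ u ∈ trappingRegion n q := fun u => ((mem_initialSet_iff hn hq).1 (hγD u)).1
  have hγpos : ∀ u k, 0 < γ u k := fun u k => ((mem_initialSet_iff hn hq).1 (hγD u)).2.1 k
  have hZpos : ∀ t ≤ 0, ∀ k, 0 < Z t k := fun t ht k =>
    coord_pos (c := fun _ => 1) ordConnected_Iic continuousOn_const hZ.smul_one (mem_Iic.2 le_rfl)
      (((mem_initialSet_iff hn hq).1 hZ0).2.1 k) t ht
  have hj0 : saddlePoint n q i j < γ 0 j := by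
    rw [saddlePoint_of_ne hij]; exact hγpos 0 j
  -- a time before which `Z` lies in the box and below `γ 0`
  obtain ⟨t₀, ht₀⟩ := eventually_atBot.1
    (((tendsto_pi_nhds.1 hZlim i).eventually (Iio_mem_nhds (saddlePoint_self_lt_boxCorner hq i))).and
      (((tendsto_pi_nhds.1 hZlim j).eventually (Iio_mem_nhds hj0)).and (eventually_le_atBot 0)))
  have ht₀0 : t₀ ≤ 0 := (ht₀ t₀ le_rfl).2.2
  have hcγ : Continuous fun u => γ u j := continuous_iff_continuousAt.2 fun u =>
    (continuous_apply j).continuousAt.comp ((hγ u (mem_univ u)).continuousWithinAt.continuousAt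
      univ_mem)
  obtain ⟨s₁, hs₁⟩ := ((tendsto_pi_nhds.1 hγlim j).eventually
    (Iio_mem_nhds (show saddlePoint n q i j < Z t₀ j by
      rw [saddlePoint_of_ne hij]; exact hZpos t₀ ht₀0 j))).exists
  obtain ⟨s₀, -, hs₀⟩ := isPreconnected_univ.intermediate_value (mem_univ s₁) (mem_univ (0 : ℝ))
    hcγ.continuousOn (show Z t₀ j ∈ Icc _ _ from ⟨le_of_lt hs₁, le_of_lt (ht₀ t₀ le_rfl).2.1⟩)
  have hZ' : IsSolutionOn n q (fun t => Z (t + t₀)) (Iic 0) :=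
    hZ.comp_add t₀ fun t ht => by simp only [mem_Iic] at ht ⊢; linarith
  have hγ' : IsSolutionOn n q (fun t => γ (t + s₀)) (Iic 0) := hγ.comp_add s₀ fun _ _ => mem_univ _
  have hZ'lim : Tendsto (fun t => Z (t + t₀)) atBot (𝓝 (saddlePoint n q i)) :=
    hZlim.comp (tendsto_atBot_add_const_right _ t₀ tendsto_id)
  have hγ'lim : Tendsto (fun t => γ (t + s₀)) atBot (𝓝 (saddlePoint n q i)) :=
    hγlim.comp (tendsto_atBot_add_const_right _ s₀ tendsto_id)
  have hZ'le : ∀ t ≤ 0, Z (t + t₀) i ≤ boxCorner n q i := fun t ht =>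
    le_of_lt (ht₀ (t + t₀) (by linarith)).1
  have hγ'le : ∀ t ≤ 0, γ (t + s₀) i ≤ boxCorner n q i := fun t _ => (hγK _).2 i
  have hZ'pos : ∀ k, 0 < Z (0 + t₀) k := fun k => hZpos _ (by linarith) k
  have hγ'pos : ∀ k, 0 < γ (0 + s₀) k := fun k => hγpos _ k
  have hj : γ (0 + s₀) j = Z (0 + t₀) j := by simpa using hs₀
  have ha := saddlePoint_self_pos (n := n) hq i
  have hi : γ (0 + s₀) i = Z (0 + t₀) i := by
    rcases lt_trichotomy (γ (0 + s₀) i) (Z (0 + t₀) i) with h | h | h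
    · exact absurd (lt_of_tendsto_atBot hq hij hγ' hZ' hγ'pos hZ'pos hγ'le hZ'le hj h hγ'lim
        hZ'lim ha) (lt_irrefl _)
    · exact h
    · exact absurd (lt_of_tendsto_atBot hq hij hZ' hγ' hZ'pos hγ'pos hZ'le hγ'le hj.symm h hZ'lim
        hγ'lim ha) (lt_irrefl _)
  have heq : γ (0 + s₀) = Z (0 + t₀) := eq_of_coords_eq hij hi hj
  refine ⟨s₀ - t₀, fun u hu => ?_⟩
  exact hZ.eqOn ordConnected_Iic (hγ.comp_add (s₀ - t₀) fun _ _ => mem_univ _) (t₀ := t₀) ht₀0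
    (by simpa using heq.symm) hu

/-! ### The region bounded by the flow lines -/

/-- The region bounded by a curve in the trapping region is contained in the trapping region: the
latter is star-shaped, so that its complement has no bounded components. -/
lemma regionBoundedBy_subset_trappingRegion (hq : ∀ i, 0 < q i) {C : Set (Fin 2 → ℝ)}
    (hC : C ⊆ trappingRegion n q) : regionBoundedBy C ⊆ trappingRegion n q := by
  rintro p (hp | ⟨-, hb⟩)
  · exact hC hp
  · by_contra hpn
    refine not_isBounded_connectedComponentIn (S := Cᶜ) (w := p) (fun h0 => ?_)
      (fun t ht hmem => ?_) hb
    · refine hpn (axisSegment_subset_trappingRegion hq 0 ?_)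
      rw [h0]
      exact left_mem_segment ℝ _ _
    · refine hpn ?_
      have h1 : p = (1 + t)⁻¹ • (p + t • p) := by
        have : (1 + t) ≠ 0 := by linarith
        rw [show p + t • p = (1 + t) • p by rw [add_smul, one_smul], smul_smul,
          inv_mul_cancel₀ this, one_smul]
      rw [h1]
      exact smul_mem_trappingRegion hq (hC hmem) (by positivity)
        (inv_le_one_of_one_le₀ (by linarith))

/-- The region bounded by a flow-invariant set is flow-invariant, since an orbit outside the set
stays in one component of its complement. -/
lemma CutoffFlow.flow_mem_regionBoundedBy (Φ : CutoffFlow n q) {C : Set (Fin 2 → ℝ)}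
    (hC : ∀ p ∈ C, ∀ t, Φ.flow p t ∈ C) {p : Fin 2 → ℝ} (hp : p ∈ regionBoundedBy C) (t : ℝ) :
    Φ.flow p t ∈ regionBoundedBy C := by
  rcases hp with hp | ⟨hp, hb⟩
  · exact Or.inl (hC p hp t)
  · have hout : ∀ s, Φ.flow p s ∈ Cᶜ := fun s hs => hp (by
      have := hC _ hs (-s)
      rwa [Φ.flow_flow, neg_add_cancel, Φ.flow_zero] at this)
    have hpre : IsPreconnected (range (Φ.flow p)) := isPreconnected_range (Φ.continuous_orbit p)
    have hsub := hpre.subset_connectedComponentIn (x := p) ⟨0, Φ.flow_zero p⟩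
      (by rintro _ ⟨s, rfl⟩; exact hout s)
    refine Or.inr ⟨hout t, ?_⟩
    rwa [← connectedComponentIn_eq (hsub ⟨t, rfl⟩)]

lemma eventually_add_mem_interior {A : Set (Fin 2 → ℝ)} {p : Fin 2 → ℝ} (hp : p ∈ interior A)
    (w : Fin 2 → ℝ) : ∀ᶠ ε in 𝓝 (0 : ℝ), p + ε • w ∈ interior A := by
  have hc : Continuous fun ε : ℝ => p + ε • w := by fun_prop
  exact hc.continuousAt.preimage_mem_nhds (by simpa using isOpen_interior.mem_nhds hp)

lemma interior_trappingRegion_subset (hn : ∀ i, 1 ≤ n i) (hq : ∀ i, 0 < q i)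
    (hη : IsInnerPoint n q η) : interior (trappingRegion n q) ⊆ initialSet n q η := by
  intro p hp
  refine (mem_initialSet_iff hn hq).2 ⟨interior_subset hp, fun k => ?_, ?_⟩
  · obtain ⟨ε, hε, hε0⟩ := ((eventually_nhdsWithin_of_eventually_nhds
      (eventually_add_mem_interior hp (Pi.single k 1))).and
      (self_mem_nhdsWithin (a := (0 : ℝ)) (s := Iio 0))).exists
    have h1 := ((interior_subset hε).1 k).1
    have h2 : ε < 0 := hε0
    simp only [Pi.add_apply, Pi.smul_apply, Pi.single_eq_same, smul_eq_mul, mul_one] at h1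
    linarith
  · -- `F₁` increases from the value `0` along the horizontal line through `η`
    rintro rfl
    have h01 : (0 : Fin 2) ≠ 1 := by decide
    obtain ⟨ε, hε, hε0⟩ := ((eventually_nhdsWithin_of_eventually_nhds
      (eventually_add_mem_interior hp (Pi.single 0 1))).and
      (self_mem_nhdsWithin (a := (0 : ℝ)) (s := Ioi 0))).exists
    have h2 : 0 < ε := hε0
    have hK := interior_subset hε
    have h3 := fieldF_sub n q h01 p (p + ε • Pi.single 0 1)
    have h4 := slope_pos hq (hK.2 0) (hη.mem.2 0)
    have h5 := (flowField_eq_zero_iff.1 hη.stationary 0).resolve_left (hη.pos 0).ne'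
    have e0 : (p + ε • (Pi.single 0 1 : Fin 2 → ℝ)) 0 - p 0 = ε := by simp
    have e1 : (p + ε • (Pi.single 0 1 : Fin 2 → ℝ)) 1 - p 1 = 0 := by simp
    rw [e0, e1, h5] at h3
    have h6 := mul_pos h4 h2
    have h7 := (hK.1 0).2
    linarith

/-- An interior point of a flow-invariant subset of the trapping region has backward limit `0`: if
its backward limit were the saddle point on the `i`-th axis, a neighbouring point further out in
the `i`-th direction would have a backward limit beyond that saddle point. -/
theorem tendsto_zero_of_mem_interior (hn : ∀ i, 1 ≤ n i) (hq : ∀ i, 0 < q i)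
    (hη : IsInnerPoint n q η) (Φ : CutoffFlow n q) {A : Set (Fin 2 → ℝ)}
    (hA : A ⊆ trappingRegion n q) (hinv : ∀ p ∈ A, ∀ t, Φ.flow p t ∈ A) {p : Fin 2 → ℝ}
    (hp : p ∈ interior A) : Tendsto (Φ.flow p) atBot (𝓝 0) := by
  have hK : ∀ x ∈ interior A, ∀ t ≤ 0, Φ.flow x t ∈ trappingRegion n q := fun x hx t _ =>
    hA (hinv x (interior_subset hx) t)
  have hD : ∀ x ∈ interior A, x ∈ initialSet n q η := fun x hx =>
    interior_trappingRegion_subset hn hq hη (interior_mono hA hx)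
  have hpos : ∀ x ∈ interior A, ∀ k, 0 < Φ.flow x 0 k := fun x hx k => by
    rw [Φ.flow_zero]; exact ((mem_initialSet_iff hn hq).1 (hD x hx)).2.1 k
  have hsol : ∀ x ∈ interior A, IsSolutionOn n q (Φ.flow x) (Iic 0) := fun x hx =>
    Φ.isSolutionOn (hK x hx)
  have hcases : ∀ x ∈ interior A, ∃ l, Tendsto (Φ.flow x) atBot (𝓝 l) ∧
      (l = 0 ∨ ∃ i, l = saddlePoint n q i) := fun x hx =>
    (hsol x hx).tendsto_atBot_cases hn hq hη Φ (hK x hx) (by rw [Φ.flow_zero]; exact hD x hx)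
  obtain ⟨l, hl, rfl | ⟨i, rfl⟩⟩ := hcases p hp
  · exact hl
  · exfalso
    obtain ⟨j, hji⟩ := exists_ne i
    have hij := hji.symm
    have ha := saddlePoint_self_pos (n := n) hq i
    obtain ⟨ε, hx, hε0⟩ := ((eventually_nhdsWithin_of_eventually_nhds
      (eventually_add_mem_interior hp (Pi.single i 1))).and
      (self_mem_nhdsWithin (a := (0 : ℝ)) (s := Ioi 0))).exists
    have hε0 : 0 < ε := hε0
    obtain ⟨m, hm, hm'⟩ := hcases _ hx
    have hlt := lt_of_tendsto_atBot hq hij (hsol p hp) (hsol _ hx) (hpos p hp) (hpos _ hx)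
      (fun t ht => (hK p hp t ht).2 i) (fun t ht => (hK _ hx t ht).2 i)
      (by simp [Φ.flow_zero, hij]) (by simpa [Φ.flow_zero] using hε0) hl hm ha
    rcases hm' with rfl | ⟨k, rfl⟩
    · exact absurd hlt (not_lt.2 ha.le)
    · rcases fin_two_eq_or hij k with rfl | rfl
      · exact lt_irrefl _ hlt
      · rw [saddlePoint_of_ne hij.symm] at hlt
        exact absurd hlt (not_lt.2 ha.le)

end

theorem mainTheorem9 (n : Fin 2 → ℕ) (hn : ∀ i, 1 ≤ n i) (q : Fin 2 → ℝ) (hq : ∀ i, 0 < q i) :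
    ∃ η ξ : Fin 2 → ℝ,
      -- there are exactly two zeros with positive coordinates, and `η` is the smaller one
      einsteinPoints n q = {η, ξ} ∧ (∀ i, η i < ξ i) ∧
      -- forward limits
      (∀ p ∈ initialSet n q η,
        (∃ Y : ℝ → Fin 2 → ℝ, IsSolutionOn n q Y (Ici 0) ∧ Y 0 = p) ∧
        ∀ Y : ℝ → Fin 2 → ℝ, IsSolutionOn n q Y (Ici 0) → Y 0 = p → Tendsto Y atTop (𝓝 η)) ∧
      ∃ γ : Fin 2 → ℝ → Fin 2 → ℝ,
        -- the flow lines with backward limits `v₁` and `v₂`, unique up to translation of time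
        (∀ i, IsSolutionOn n q (γ i) univ ∧ (∀ u, γ i u ∈ initialSet n q η) ∧
          Tendsto (γ i) atBot (𝓝 (saddlePoint n q i)) ∧
          ∀ Z : ℝ → Fin 2 → ℝ, IsSolutionOn n q Z (Iic 0) → Z 0 ∈ initialSet n q η →
            Tendsto Z atBot (𝓝 (saddlePoint n q i)) → ∃ s : ℝ, ∀ u ≤ 0, Z u = γ i (u + s)) ∧
        -- backward limits in the interior of the region bounded by the flow lines
        omegaTwoStar n q η γ ⊆ omegaTwo n q ∧
        ∀ p ∈ interior (omegaTwoStar n q η γ),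
          (∃ Y : ℝ → Fin 2 → ℝ, IsSolutionOn n q Y (Iic 0) ∧ Y 0 = p) ∧
          ∀ Y : ℝ → Fin 2 → ℝ, IsSolutionOn n q Y (Iic 0) → Y 0 = p → Tendsto Y atBot (𝓝 0) := by
  obtain ⟨η, ξ, hE, hlt, hηK, hξK⟩ := exists_einsteinPoints hn hq
  obtain ⟨Φ⟩ := nonempty_cutoffFlow n q
  have hηE : η ∈ einsteinPoints n q := by rw [hE]; exact Or.inl rfl
  have hη : IsInnerPoint n q η := ⟨hηK, hηE.1, hηE.2, fun Y hY hYE => by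
    rw [hE] at hYE
    rcases hYE with h | h
    · exact h
    · rw [mem_singleton_iff.1 h] at hY
      exact absurd hY hξK⟩
  refine ⟨η, ξ, hE, hlt, fun p hp => ⟨⟨Φ.flow p, Φ.isSolutionOn fun t ht =>
    Φ.flow_mem_trappingRegion hn hq ((mem_initialSet_iff hn hq).1 hp).1 ht, Φ.flow_zero p⟩,
    fun Y hY h0 => (hY.tendsto_innerPoint hn hq hη (by rwa [h0])).1⟩, ?_⟩
  choose p hpD hpK hplim using exists_orbit_from_saddlePoint hn hq hη Φ
  have hsol : ∀ i, IsSolutionOn n q (Φ.flow (p i)) univ := fun i =>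
    Φ.isSolutionOn fun t _ => hpK i t
  have hD : ∀ i u, Φ.flow (p i) u ∈ initialSet n q η := fun i u =>
    flow_mem_initialSet hn hq hη Φ (hpD i) (hpK i u)
  have hCK : axisSegment n q 0 ∪ axisSegment n q 1 ∪ range (Φ.flow (p 0)) ∪
      (range (Φ.flow (p 1)) ∪ {η}) ⊆ trappingRegion n q := by
    rintro x (((hx | hx) | ⟨t, rfl⟩) | (⟨t, rfl⟩ | rfl))
    · exact axisSegment_subset_trappingRegion hq 0 hx
    · exact axisSegment_subset_trappingRegion hq 1 hx
    · exact hpK 0 t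
    · exact hpK 1 t
    · exact hη.mem
  have hCinv : ∀ x ∈ axisSegment n q 0 ∪ axisSegment n q 1 ∪ range (Φ.flow (p 0)) ∪
      (range (Φ.flow (p 1)) ∪ {η}), ∀ t, Φ.flow x t ∈ axisSegment n q 0 ∪ axisSegment n q 1 ∪
      range (Φ.flow (p 0)) ∪ (range (Φ.flow (p 1)) ∪ {η}) := by
    rintro x (((hx | hx) | ⟨s, rfl⟩) | (⟨s, rfl⟩ | rfl)) t
    · exact Or.inl (Or.inl (Or.inl (Φ.flow_mem_axisSegment hq hx t)))
    · exact Or.inl (Or.inl (Or.inr (Φ.flow_mem_axisSegment hq hx t)))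
    · exact Or.inl (Or.inr ⟨t + s, (Φ.flow_flow _ s t).symm⟩)
    · exact Or.inr (Or.inl ⟨t + s, (Φ.flow_flow _ s t).symm⟩)
    · exact Or.inr (Or.inr (Φ.flow_eq_self hη.stationary t))
  have hsub : omegaTwoStar n q η (fun i => Φ.flow (p i)) ⊆ trappingRegion n q :=
    regionBoundedBy_subset_trappingRegion hq hCK
  have hinv : ∀ x ∈ omegaTwoStar n q η (fun i => Φ.flow (p i)), ∀ t,
      Φ.flow x t ∈ omegaTwoStar n q η (fun i => Φ.flow (p i)) := fun x hx t =>
    Φ.flow_mem_regionBoundedBy hCinv hx t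
  refine ⟨fun i => Φ.flow (p i), fun i => ⟨hsol i, hD i, hplim i, fun Z hZ hZ0 hZlim =>
    eq_translate_of_tendsto_saddlePoint hn hq (hsol i) (hD i) (hplim i) hZ hZ0 hZlim⟩, ?_,
    fun x hx => ?_⟩
  · rw [omegaTwo_eq_trappingRegion hn hq]; exact hsub
  · have hΦ : IsSolutionOn n q (Φ.flow x) (Iic 0) :=
      Φ.isSolutionOn fun t _ => hsub (hinv x (interior_subset hx) t)
    refine ⟨⟨Φ.flow x, hΦ, Φ.flow_zero x⟩, fun Y hY h0 => ?_⟩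
    refine (tendsto_zero_of_mem_interior hn hq hη Φ hsub hinv hx).congr' ?_
    filter_upwards [eventually_le_atBot 0] with t ht
    exact hΦ.eqOn ordConnected_Iic hY (t₀ := 0) (mem_Iic.2 le_rfl)
      (by rw [Φ.flow_zero, h0]) ht
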